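/- Let $k$ be a field of characteristic zero, and let $\mathfrak g,\mathfrak h$ be nilpotent non-negatively graded dg Lie algebras over $k$ (differential of degree $1$; nilpotent means that the lower central series $F^1\mathfrak g=\mathfrak g$, $F^{i+1}\mathfrak g=[\mathfrak g,F^i\mathfrak g]$ reaches $0$). Let $f:\mathfrak g\to\mathfrak h$ be an acyclic fibration of nilpotent dg Lie algebras, i.e. a surjective morphism of dg Lie algebras such that $F^i\mathfrak g\to F^i\mathfrak h$ is a quasi-isomorphism for every $i\ge 1$. For $n\ge 0$ let $\Omega_n=k[t_0,\dots,t_n,dt_0,\dots,dt_n]/(\sum t_i-1,\sum dt_i)$ be the commutative dg algebra of polynomial differential forms on the standard $n$-simplex; a monotone map $u:[p]\to[q]$ induces $\Omega_q\to\Omega_p$, $t_i\mapsto\sum_{u(j)=i}t_j$. For a nilpotent dg Lie algebra $\mathfrak g$ let $\Sigma(\mathfrak g)$ be the simplicial set $$\Sigma(\mathfrak g)_n=\mathrm{MC}(\Omega_n\otimes_k\mathfrak g),\qquad \mathrm{MC}(L)=\{x\in L^1 : dx+\tfrac12[x,x]=0\}.$$ Then $\Sigma(f):\Sigma(\mathfrak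 g)\to\Sigma(\mathfrak h)$ is an acyclic fibration of simplicial sets, i.e. a Kan fibration and a weak homotopy equivalence; moreover, it has the right lifting property with respect to every injective map of simplicial sets (this is an equivalent description of acyclic fibrations). -/

import Mathlib

open CategoryTheory
open scoped TensorProduct DirectSum

universe u v w

noncomputable section

/-! ### Graded vector spaces: Koszul signs and tensor products -/

namespace GradedKoszul

variable {k : Type u} [Field k] {V : Type v} [AddCommGroup V] [Module k V]
  {W : Type w} [AddCommGroup W] [Module k W]
  (𝒜 : ℕ → Submodule k V) (ℬ : ℕ → Submodule k W)

/-- The sign involution `v ↦ (-1) ^ |v| v` of a graded vector space. -/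
def parity [DirectSum.Decomposition 𝒜] : V →ₗ[k] V :=
  DirectSum.toModule k ℕ V (fun n => (-1 : k) ^ n • (𝒜 n).subtype) ∘ₗ
    (DirectSum.decomposeLinearEquiv 𝒜).toLinearMap

theorem parity_of_mem [DirectSum.Decomposition 𝒜] {n : ℕ} {v : V} (hv : v ∈ 𝒜 n) :
    parity 𝒜 v = (-1 : k) ^ n • v := by
  lift v to 𝒜 n using hv
  simp [parity, DirectSum.toModule_lof]

/-- The Koszul symmetry `v ⊗ w ↦ (-1) ^ (|v| |w|) w ⊗ v` of graded vector spaces. -/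
def swap [DirectSum.Decomposition 𝒜] [DirectSum.Decomposition ℬ] : V ⊗[k] W →ₗ[k] W ⊗[k] V :=
  TensorProduct.map (DirectSum.decomposeLinearEquiv ℬ).symm.toLinearMap
      (DirectSum.decomposeLinearEquiv 𝒜).symm.toLinearMap ∘ₗ
    (TensorProduct.gradedComm k (fun i => 𝒜 i) (fun i => ℬ i)).toLinearMap ∘ₗ
    TensorProduct.map (DirectSum.decomposeLinearEquiv 𝒜).toLinearMap
      (DirectSum.decomposeLinearEquiv ℬ).toLinearMap

theorem swap_tmul_of_mem [DirectSum.Decomposition 𝒜] [DirectSum.Decomposition ℬ]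
    {m n : ℕ} {v : V} {w : W} (hv : v ∈ 𝒜 m) (hw : w ∈ ℬ n) :
    swap 𝒜 ℬ (v ⊗ₜ w) = (-1 : k) ^ (m * n) • (w ⊗ₜ[k] v) := by
  lift v to 𝒜 m using hv
  lift w to ℬ n using hw
  have h := TensorProduct.gradedComm_of_tmul_of k (fun i => 𝒜 i) (fun i => ℬ i) m n v w
  simp only [swap, LinearMap.comp_apply, LinearEquiv.coe_coe, TensorProduct.map_tmul,
    DirectSum.decomposeLinearEquiv_apply_coe]
  rw [h, Units.smul_def, ← Int.cast_smul_eq_zsmul k, map_smul, TensorProduct.map_tmul]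
  simp [mul_comm n m]

/-- The degree `n` part of `V ⊗ W` is spanned by the `v ⊗ w` with `|v| + |w| = n`. -/
def tensorDeg (n : ℕ) : Submodule k (V ⊗[k] W) :=
  Submodule.span k {z | ∃ i j, i + j = n ∧ ∃ v ∈ 𝒜 i, ∃ w ∈ ℬ j, z = v ⊗ₜ[k] w}

theorem tmul_mem_tensorDeg {i j n : ℕ} {v : V} {w : W} (h : i + j = n) (hv : v ∈ 𝒜 i)
    (hw : w ∈ ℬ j) : v ⊗ₜ[k] w ∈ tensorDeg 𝒜 ℬ n :=
  Submodule.subset_span ⟨i, j, h, v, hv, w, hw, rfl⟩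

/-- The projection of `V ⊗ W` to its homogeneous components. -/
def tensorDecompose [DirectSum.Decomposition 𝒜] [DirectSum.Decomposition ℬ] :
    V ⊗[k] W →ₗ[k] ⨁ n, tensorDeg 𝒜 ℬ n :=
  DirectSum.toModule k (ℕ × ℕ) (⨁ n, tensorDeg 𝒜 ℬ n) (fun p =>
      DirectSum.lof k ℕ (fun n => tensorDeg 𝒜 ℬ n) (p.1 + p.2) ∘ₗ
        (TensorProduct.mapIncl (𝒜 p.1) (ℬ p.2)).codRestrict (tensorDeg 𝒜 ℬ (p.1 + p.2)) (by
          intro z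
          induction z with
          | zero => simp
          | add a b ha hb => rw [map_add]; exact add_mem ha hb
          | tmul a b => exact tmul_mem_tensorDeg 𝒜 ℬ rfl a.2 b.2)) ∘ₗ
    (TensorProduct.directSum k k (fun i => 𝒜 i) (fun i => ℬ i)).toLinearMap ∘ₗ
    TensorProduct.map (DirectSum.decomposeLinearEquiv 𝒜).toLinearMap
      (DirectSum.decomposeLinearEquiv ℬ).toLinearMap

theorem tensorDecompose_tmul [DirectSum.Decomposition 𝒜] [DirectSum.Decomposition ℬ]
    {i j : ℕ} {v : V} {w : W} (hv : v ∈ 𝒜 i) (hw : w ∈ ℬ j) :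
    tensorDecompose 𝒜 ℬ (v ⊗ₜ w) = DirectSum.lof k ℕ (fun n => tensorDeg 𝒜 ℬ n) (i + j)
      ⟨v ⊗ₜ w, tmul_mem_tensorDeg 𝒜 ℬ rfl hv hw⟩ := by
  lift v to 𝒜 i using hv
  lift w to ℬ j using hw
  have h := TensorProduct.directSum_lof_tmul_lof (R := k) (S := k)
    (M₁ := fun i => 𝒜 i) (M₂ := fun i => ℬ i) i v j w
  simp only [tensorDecompose, LinearMap.comp_apply, LinearEquiv.coe_coe, TensorProduct.map_tmul,
    DirectSum.decomposeLinearEquiv_apply_coe]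
  rw [h, DirectSum.toModule_lof]
  rfl

/-- Linear maps out of `V ⊗ W` agree once they agree on tensors of homogeneous elements. -/
theorem hom_ext [DirectSum.Decomposition 𝒜] [DirectSum.Decomposition ℬ]
    {U : Type*} [AddCommGroup U] [Module k U] {f g : V ⊗[k] W →ₗ[k] U}
    (h : ∀ i j, ∀ v ∈ 𝒜 i, ∀ w ∈ ℬ j, f (v ⊗ₜ w) = g (v ⊗ₜ w)) : f = g := by
  refine TensorProduct.ext ?_
  refine DirectSum.decompose_lhom_ext 𝒜 fun i => LinearMap.ext fun v => ?_
  refine DirectSum.decompose_lhom_ext ℬ fun j => LinearMap.ext fun w => ?_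
  exact h i j v v.2 w w.2

instance tensorDecomposition [DirectSum.Decomposition 𝒜] [DirectSum.Decomposition ℬ] :
    DirectSum.Decomposition (tensorDeg 𝒜 ℬ) :=
  DirectSum.Decomposition.ofLinearMap (tensorDeg 𝒜 ℬ) (tensorDecompose 𝒜 ℬ)
    (by
      refine hom_ext 𝒜 ℬ fun i j v hv w hw => ?_
      rw [LinearMap.comp_apply, tensorDecompose_tmul 𝒜 ℬ hv hw]
      simp)
    (by
      refine DirectSum.linearMap_ext k fun n => LinearMap.ext fun z => ?_
      obtain ⟨z, hz⟩ := z
      simp only [LinearMap.comp_apply, DirectSum.coeLinearMap_lof, LinearMap.id_apply]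
      induction hz using Submodule.span_induction with
      | mem z h =>
        obtain ⟨i, j, rfl, v, hv, w, hw, rfl⟩ := h
        exact tensorDecompose_tmul 𝒜 ℬ hv hw
      | zero => rw [map_zero]; exact (map_zero _).symm
      | add a b ha hb iha ihb => rw [map_add, iha, ihb, ← map_add]; rfl
      | smul r a ha iha => rw [map_smul, iha, ← map_smul]; rfl)

end GradedKoszul

/-! ### Commutative dg algebras and dg Lie algebras -/

/-- A non-negatively graded commutative dg algebra (with unit) over `k`, with a differential of
degree `1`. -/
structure CommDGAlgebra (k : Type u) [Field k] where
  carrier : Type v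
  [ring : Ring carrier]
  [algebra : Algebra k carrier]
  deg : ℕ → Submodule k carrier
  [graded : GradedAlgebra deg]
  d : carrier →ₗ[k] carrier
  d_mem : ∀ {n : ℕ} {a : carrier}, a ∈ deg n → d a ∈ deg (n + 1)
  d_d : ∀ a, d (d a) = 0
  leibniz : ∀ {n : ℕ} {a : carrier} (b : carrier), a ∈ deg n →
    d (a * b) = d a * b + (-1 : k) ^ n • (a * d b)
  comm : ∀ {m n : ℕ} {a b : carrier}, a ∈ deg m → b ∈ deg n →
    a * b = (-1 : k) ^ (m * n) • (b * a)

attribute [instance] CommDGAlgebra.ring CommDGAlgebra.algebra CommDGAlgebra.graded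

/-- A non-negatively graded dg Lie algebra over `k`, with a differential of degree `1`. -/
structure DGLieAlgebra (k : Type u) [Field k] where
  carrier : Type v
  [addCommGroup : AddCommGroup carrier]
  [module : Module k carrier]
  deg : ℕ → Submodule k carrier
  [decomposition : DirectSum.Decomposition deg]
  d : carrier →ₗ[k] carrier
  bracket : carrier →ₗ[k] carrier →ₗ[k] carrier
  d_mem : ∀ {n : ℕ} {x : carrier}, x ∈ deg n → d x ∈ deg (n + 1)
  d_d : ∀ x, d (d x) = 0
  bracket_mem : ∀ {m n : ℕ} {x y : carrier}, x ∈ deg m → y ∈ deg n → bracket x y ∈ deg (m + n)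
  leibniz : ∀ {n : ℕ} {x : carrier} (y : carrier), x ∈ deg n →
    d (bracket x y) = bracket (d x) y + (-1 : k) ^ n • bracket x (d y)
  antisymm : ∀ {m n : ℕ} {x y : carrier}, x ∈ deg m → y ∈ deg n →
    bracket x y = -((-1 : k) ^ (m * n) • bracket y x)
  jacobi : ∀ {m n : ℕ} {x y : carrier} (z : carrier), x ∈ deg m → y ∈ deg n →
    bracket x (bracket y z) = bracket (bracket x y) z + (-1 : k) ^ (m * n) • bracket y (bracket x z)

attribute [instance] DGLieAlgebra.addCommGroup DGLieAlgebra.module DGLieAlgebra.decomposition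

/-- Morphisms of commutative dg algebras. -/
structure CommDGAlgebra.Hom {k : Type u} [Field k] (A : CommDGAlgebra.{u, v} k)
    (B : CommDGAlgebra.{u, w} k) where
  toAlgHom : A.carrier →ₐ[k] B.carrier
  map_deg : ∀ {n : ℕ} {a : A.carrier}, a ∈ A.deg n → toAlgHom a ∈ B.deg n
  map_d : ∀ a, toAlgHom (A.d a) = B.d (toAlgHom a)

/-- Morphisms of dg Lie algebras. -/
structure DGLieAlgebra.Hom {k : Type u} [Field k] (g : DGLieAlgebra.{u, v} k)
    (h : DGLieAlgebra.{u, w} k) where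
  toLinearMap : g.carrier →ₗ[k] h.carrier
  map_deg : ∀ {n : ℕ} {x : g.carrier}, x ∈ g.deg n → toLinearMap x ∈ h.deg n
  map_d : ∀ x, toLinearMap (g.d x) = h.d (toLinearMap x)
  map_bracket : ∀ x y, toLinearMap (g.bracket x y) = h.bracket (toLinearMap x) (toLinearMap y)

/-! ### The dg Lie algebra `A ⊗ g` -/

namespace DGLieAlgebra

open GradedKoszul

variable {k : Type u} [Field k] (A : CommDGAlgebra.{u, v} k) (g : DGLieAlgebra.{u, w} k)

/-- The differential `a ⊗ x ↦ da ⊗ x + (-1) ^ |a| a ⊗ dx`. -/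
def tensorD : A.carrier ⊗[k] g.carrier →ₗ[k] A.carrier ⊗[k] g.carrier :=
  TensorProduct.map A.d LinearMap.id + TensorProduct.map (parity A.deg) g.d

/-- The bracket `[a ⊗ x, b ⊗ y] = (-1) ^ (|x| |b|) ab ⊗ [x, y]`. -/
def tensorBracket : A.carrier ⊗[k] g.carrier →ₗ[k]
    A.carrier ⊗[k] g.carrier →ₗ[k] A.carrier ⊗[k] g.carrier :=
  TensorProduct.curry
    (TensorProduct.map (LinearMap.mul' k A.carrier) (TensorProduct.lift g.bracket) ∘ₗ
      (TensorProduct.assoc k A.carrier A.carrier (g.carrier ⊗[k] g.carrier)).symm.toLinearMap ∘ₗ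
      LinearMap.lTensor A.carrier
        ((TensorProduct.assoc k A.carrier g.carrier g.carrier).toLinearMap ∘ₗ
          LinearMap.rTensor g.carrier (swap g.deg A.deg) ∘ₗ
          (TensorProduct.assoc k g.carrier A.carrier g.carrier).symm.toLinearMap) ∘ₗ
      (TensorProduct.assoc k A.carrier g.carrier (A.carrier ⊗[k] g.carrier)).toLinearMap)

theorem tensorD_tmul {i : ℕ} {a : A.carrier} (ha : a ∈ A.deg i) (x : g.carrier) :
    tensorD A g (a ⊗ₜ x) = A.d a ⊗ₜ x + (-1 : k) ^ i • (a ⊗ₜ[k] g.d x) := by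
  simp [tensorD, parity_of_mem A.deg ha, TensorProduct.smul_tmul']

theorem tensorBracket_tmul {i j : ℕ} (a : A.carrier) {x : g.carrier} (hx : x ∈ g.deg i)
    {b : A.carrier} (hb : b ∈ A.deg j) (y : g.carrier) :
    tensorBracket A g (a ⊗ₜ x) (b ⊗ₜ y) = (-1 : k) ^ (i * j) • ((a * b) ⊗ₜ[k] g.bracket x y) := by
  simp only [tensorBracket, TensorProduct.curry_apply, LinearMap.comp_apply, LinearEquiv.coe_coe,
    TensorProduct.assoc_tmul, LinearMap.lTensor_tmul, TensorProduct.assoc_symm_tmul,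
    LinearMap.rTensor_tmul, swap_tmul_of_mem g.deg A.deg hx hb]
  simp only [← TensorProduct.smul_tmul', TensorProduct.tmul_smul, map_smul,
    TensorProduct.assoc_tmul, TensorProduct.assoc_symm_tmul, TensorProduct.map_tmul,
    LinearMap.mul'_apply, TensorProduct.lift.tmul]

variable {A g} in
/-- Linear maps agree on the degree `n` part of `A ⊗ g` once they agree on its generators. -/
theorem eq_of_mem_tensorDeg {U : Type*} [AddCommGroup U] [Module k U]
    (p q : A.carrier ⊗[k] g.carrier →ₗ[k] U) {n : ℕ}
    (h : ∀ i j, i + j = n → ∀ a ∈ A.deg i, ∀ x ∈ g.deg j, p (a ⊗ₜ x) = q (a ⊗ₜ x))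
    {z : A.carrier ⊗[k] g.carrier} (hz : z ∈ tensorDeg A.deg g.deg n) : p z = q z := by
  refine LinearMap.eqOn_span (f := p) (g := q) ?_ hz
  rintro _ ⟨i, j, hij, a, ha, x, hx, rfl⟩
  exact h i j hij a ha x hx

theorem tensorD_mem {n : ℕ} {z : A.carrier ⊗[k] g.carrier} (hz : z ∈ tensorDeg A.deg g.deg n) :
    tensorD A g z ∈ tensorDeg A.deg g.deg (n + 1) := by
  refine Submodule.span_le (p := (tensorDeg A.deg g.deg (n + 1)).comap (tensorD A g)).2 ?_ hz
  rintro _ ⟨i, j, rfl, a, ha, x, hx, rfl⟩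
  show tensorD A g (a ⊗ₜ x) ∈ tensorDeg A.deg g.deg _
  rw [tensorD_tmul A g ha]
  exact add_mem (tmul_mem_tensorDeg _ _ (by omega) (A.d_mem ha) hx)
    (Submodule.smul_mem _ _ (tmul_mem_tensorDeg _ _ (by omega) ha (g.d_mem hx)))

theorem tensorD_tensorD (z : A.carrier ⊗[k] g.carrier) : tensorD A g (tensorD A g z) = 0 := by
  have : tensorD A g ∘ₗ tensorD A g = 0 := by
    refine hom_ext A.deg g.deg fun i j a ha x hx => ?_
    rw [LinearMap.comp_apply, tensorD_tmul A g ha, map_add, map_smul,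
      tensorD_tmul A g (A.d_mem ha), tensorD_tmul A g ha, A.d_d, g.d_d, pow_succ]
    simp only [TensorProduct.zero_tmul, TensorProduct.tmul_zero, LinearMap.zero_apply]
    module
  exact LinearMap.congr_fun this z

theorem tensorBracket_mem {m n : ℕ} {z w : A.carrier ⊗[k] g.carrier}
    (hz : z ∈ tensorDeg A.deg g.deg m) (hw : w ∈ tensorDeg A.deg g.deg n) :
    tensorBracket A g z w ∈ tensorDeg A.deg g.deg (m + n) := by
  refine Submodule.span_le
    (p := (tensorDeg A.deg g.deg (m + n)).comap ((tensorBracket A g).flip w)).2 ?_ hz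
  rintro _ ⟨i, j, rfl, a, ha, x, hx, rfl⟩
  refine Submodule.span_le
    (p := (tensorDeg A.deg g.deg (i + j + n)).comap (tensorBracket A g (a ⊗ₜ x))).2 ?_ hw
  rintro _ ⟨p, q, rfl, b, hb, y, hy, rfl⟩
  show tensorBracket A g (a ⊗ₜ x) (b ⊗ₜ y) ∈ tensorDeg A.deg g.deg _
  rw [tensorBracket_tmul A g a hx hb]
  exact Submodule.smul_mem _ _ (tmul_mem_tensorDeg _ _ (by omega)
    (SetLike.mul_mem_graded ha hb) (g.bracket_mem hx hy))

theorem tensor_leibniz {n : ℕ} {z : A.carrier ⊗[k] g.carrier} (w : A.carrier ⊗[k] g.carrier)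
    (hz : z ∈ tensorDeg A.deg g.deg n) :
    tensorD A g (tensorBracket A g z w) =
      tensorBracket A g (tensorD A g z) w + (-1 : k) ^ n • tensorBracket A g z (tensorD A g w) := by
  refine eq_of_mem_tensorDeg (tensorD A g ∘ₗ (tensorBracket A g).flip w)
    ((tensorBracket A g).flip w ∘ₗ tensorD A g +
      (-1 : k) ^ n • (tensorBracket A g).flip (tensorD A g w)) ?_ hz
  rintro i j rfl a ha x hx
  refine LinearMap.congr_fun (f := tensorD A g ∘ₗ tensorBracket A g (a ⊗ₜ x))
    (g := tensorBracket A g (tensorD A g (a ⊗ₜ x)) +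
      (-1 : k) ^ (i + j) • (tensorBracket A g (a ⊗ₜ x) ∘ₗ tensorD A g)) ?_ w
  refine hom_ext A.deg g.deg fun p q b hb y hy => ?_
  simp only [LinearMap.comp_apply, LinearMap.add_apply, LinearMap.smul_apply, map_add, map_smul,
    tensorD_tmul A g ha, tensorD_tmul A g hb, tensorBracket_tmul A g _ hx hb,
    tensorBracket_tmul A g _ (g.d_mem hx) hb, tensorBracket_tmul A g _ hx (A.d_mem hb),
    tensorD_tmul A g (SetLike.mul_mem_graded ha hb), A.leibniz b ha, g.leibniz y hx,
    TensorProduct.add_tmul, TensorProduct.tmul_add, ← TensorProduct.smul_tmul',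
    TensorProduct.tmul_smul]
  simp only [add_mul, mul_add, pow_add, one_mul, mul_one]
  rcases neg_one_pow_eq_or k i with h1 | h1 <;> rcases neg_one_pow_eq_or k j with h2 | h2 <;>
    rcases neg_one_pow_eq_or k p with h3 | h3 <;> rw [h1, h2, h3] <;> module

theorem tensor_antisymm {m n : ℕ} {z w : A.carrier ⊗[k] g.carrier}
    (hz : z ∈ tensorDeg A.deg g.deg m) (hw : w ∈ tensorDeg A.deg g.deg n) :
    tensorBracket A g z w = -((-1 : k) ^ (m * n) • tensorBracket A g w z) := by
  refine eq_of_mem_tensorDeg ((tensorBracket A g).flip w)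
    (-((-1 : k) ^ (m * n) • tensorBracket A g w)) ?_ hz
  rintro i j rfl a ha x hx
  refine eq_of_mem_tensorDeg (tensorBracket A g (a ⊗ₜ x))
    (-((-1 : k) ^ ((i + j) * n) • (tensorBracket A g).flip (a ⊗ₜ x))) ?_ hw
  rintro p q rfl b hb y hy
  simp only [LinearMap.neg_apply, LinearMap.smul_apply, LinearMap.flip_apply,
    tensorBracket_tmul A g _ hx hb, tensorBracket_tmul A g _ hy ha]
  rw [A.comm ha hb, g.antisymm hx hy]
  simp only [TensorProduct.tmul_neg, ← TensorProduct.smul_tmul', TensorProduct.tmul_smul]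
  have e1 : (-1 : k) ^ ((i + j) * (p + q)) = (-1 : k) ^ (i * p) * (-1 : k) ^ (q * i) *
      ((-1 : k) ^ (j * p) * (-1 : k) ^ (j * q)) := by
    rw [← pow_add, ← pow_add, ← pow_add]; congr 1; ring
  rw [e1]
  rcases neg_one_pow_eq_or k (i * p) with h1 | h1 <;>
    rcases neg_one_pow_eq_or k (j * p) with h2 | h2 <;>
    rcases neg_one_pow_eq_or k (q * i) with h3 | h3 <;>
    rcases neg_one_pow_eq_or k (j * q) with h4 | h4 <;> rw [h1, h2, h3, h4] <;> module

theorem tensor_jacobi {m n : ℕ} {z w : A.carrier ⊗[k] g.carrier} (t : A.carrier ⊗[k] g.carrier)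
    (hz : z ∈ tensorDeg A.deg g.deg m) (hw : w ∈ tensorDeg A.deg g.deg n) :
    tensorBracket A g z (tensorBracket A g w t) = tensorBracket A g (tensorBracket A g z w) t +
      (-1 : k) ^ (m * n) • tensorBracket A g w (tensorBracket A g z t) := by
  refine eq_of_mem_tensorDeg ((tensorBracket A g).flip (tensorBracket A g w t))
    ((tensorBracket A g).flip t ∘ₗ (tensorBracket A g).flip w +
      (-1 : k) ^ (m * n) • (tensorBracket A g w ∘ₗ (tensorBracket A g).flip t)) ?_ hz
  rintro i j rfl a ha x hx
  refine eq_of_mem_tensorDeg (tensorBracket A g (a ⊗ₜ x) ∘ₗ (tensorBracket A g).flip t)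
    ((tensorBracket A g).flip t ∘ₗ tensorBracket A g (a ⊗ₜ x) +
      (-1 : k) ^ ((i + j) * n) • (tensorBracket A g).flip (tensorBracket A g (a ⊗ₜ x) t)) ?_ hw
  rintro p q rfl b hb y hy
  refine LinearMap.congr_fun
    (f := tensorBracket A g (a ⊗ₜ x) ∘ₗ tensorBracket A g (b ⊗ₜ y))
    (g := tensorBracket A g (tensorBracket A g (a ⊗ₜ x) (b ⊗ₜ y)) +
      (-1 : k) ^ ((i + j) * (p + q)) •
        (tensorBracket A g (b ⊗ₜ y) ∘ₗ tensorBracket A g (a ⊗ₜ x))) ?_ t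
  refine hom_ext A.deg g.deg fun r s c hc z hz => ?_
  simp only [LinearMap.comp_apply, LinearMap.add_apply, LinearMap.smul_apply, map_smul,
    tensorBracket_tmul A g _ hx hb, tensorBracket_tmul A g _ hy hc, tensorBracket_tmul A g _ hx hc,
    tensorBracket_tmul A g _ hx (SetLike.mul_mem_graded hb hc),
    tensorBracket_tmul A g _ hy (SetLike.mul_mem_graded ha hc),
    tensorBracket_tmul A g _ (g.bracket_mem hx hy) hc]
  have e : b * (a * c) = (-1 : k) ^ (p * i) • (a * (b * c)) := by
    rw [← mul_assoc, A.comm hb ha, smul_mul_assoc, mul_assoc]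
  have e1 : (-1 : k) ^ ((i + j) * (p + q)) = (-1 : k) ^ (p * i) * (-1 : k) ^ (q * i) *
      ((-1 : k) ^ (j * p) * (-1 : k) ^ (j * q)) := by
    rw [← pow_add, ← pow_add, ← pow_add]; congr 1; ring
  rw [e, e1, g.jacobi z hx hy, mul_assoc a b c]
  simp only [TensorProduct.tmul_add, ← TensorProduct.smul_tmul', TensorProduct.tmul_smul,
    mul_add, add_mul, pow_add]
  rcases neg_one_pow_eq_or k (p * i) with h1 | h1 <;>
    rcases neg_one_pow_eq_or k (j * p) with h2 | h2 <;>
    rcases neg_one_pow_eq_or k (q * i) with h3 | h3 <;>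
    rcases neg_one_pow_eq_or k (j * q) with h4 | h4 <;> rw [h1, h2, h3, h4] <;> module

/-- The dg Lie algebra `A ⊗ g`, for a commutative dg algebra `A` and a dg Lie algebra `g`. -/
def tensor : DGLieAlgebra.{u, max v w} k where
  carrier := A.carrier ⊗[k] g.carrier
  deg := tensorDeg A.deg g.deg
  d := tensorD A g
  bracket := tensorBracket A g
  d_mem := tensorD_mem A g
  d_d := tensorD_tensorD A g
  bracket_mem := tensorBracket_mem A g
  leibniz := tensor_leibniz A g
  antisymm := tensor_antisymm A g
  jacobi := tensor_jacobi A g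

/-- The morphism `A ⊗ g → B ⊗ h` induced by morphisms `A → B` and `g → h`. -/
def tensorMap {k : Type u} [Field k] {A B : CommDGAlgebra.{u, v} k} {g h : DGLieAlgebra.{u, w} k}
    (φ : A.Hom B) (f : g.Hom h) : (tensor A g).Hom (tensor B h) where
  toLinearMap := TensorProduct.map φ.toAlgHom.toLinearMap f.toLinearMap
  map_deg {n z} hz := by
    refine Submodule.span_le (p := (tensorDeg B.deg h.deg n).comap
      (TensorProduct.map φ.toAlgHom.toLinearMap f.toLinearMap)).2 ?_ hz
    rintro _ ⟨i, j, rfl, a, ha, x, hx, rfl⟩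
    exact tmul_mem_tensorDeg B.deg h.deg rfl (φ.map_deg ha) (f.map_deg hx)
  map_d z := by
    refine LinearMap.congr_fun
      (f := TensorProduct.map φ.toAlgHom.toLinearMap f.toLinearMap ∘ₗ tensorD A g)
      (g := tensorD B h ∘ₗ TensorProduct.map φ.toAlgHom.toLinearMap f.toLinearMap) ?_ z
    refine hom_ext A.deg g.deg fun i j a ha x hx => ?_
    simp only [LinearMap.comp_apply, tensorD_tmul A g ha, map_add, map_smul,
      TensorProduct.map_tmul, AlgHom.toLinearMap_apply, tensorD_tmul B h (φ.map_deg ha), φ.map_d,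
      f.map_d]
  map_bracket z w := by
    let F := TensorProduct.map φ.toAlgHom.toLinearMap f.toLinearMap
    refine LinearMap.congr_fun (f := F ∘ₗ (tensorBracket A g).flip w)
      (g := (tensorBracket B h).flip (F w) ∘ₗ F) ?_ z
    refine hom_ext A.deg g.deg fun i j a ha x hx => ?_
    refine LinearMap.congr_fun (f := F ∘ₗ tensorBracket A g (a ⊗ₜ x))
      (g := tensorBracket B h (F (a ⊗ₜ x)) ∘ₗ F) ?_ w
    refine hom_ext A.deg g.deg fun p q b hb y hy => ?_
    simp only [F, LinearMap.comp_apply, tensorBracket_tmul A g _ hx hb, map_smul,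
      TensorProduct.map_tmul, AlgHom.toLinearMap_apply,
      tensorBracket_tmul B h _ (f.map_deg hx) (φ.map_deg hb), map_mul, f.map_bracket]

/-! ### Maurer--Cartan elements -/

/-- The set of `x` of degree `1` with `dx + (1/2) [x, x] = 0`. -/
def MC : Set g.carrier :=
  {x | x ∈ g.deg 1 ∧ g.d x + (1 / 2 : k) • g.bracket x x = 0}

variable {g} in
theorem Hom.map_mem_MC {h : DGLieAlgebra.{u, v} k} (f : g.Hom h) {x : g.carrier} (hx : x ∈ g.MC) :
    f.toLinearMap x ∈ h.MC :=
  ⟨f.map_deg hx.1, by rw [← f.map_d, ← f.map_bracket, ← map_smul, ← map_add, hx.2, map_zero]⟩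

/-! ### Lower central series, nilpotence and acyclic fibrations -/

/-- The lower central series, `lcs 0 = g` and `lcs (i + 1) = [g, lcs i]`. -/
def lcs : ℕ → Submodule k g.carrier
  | 0 => ⊤
  | i + 1 => Submodule.span k {z | ∃ x, ∃ y ∈ lcs i, z = g.bracket x y}

/-- `g` is nilpotent if its lower central series reaches zero. -/
def IsNilpotent : Prop :=
  ∃ n, g.lcs n = ⊥

theorem bracket_mem_lcs {i : ℕ} (x : g.carrier) {y : g.carrier} (hy : y ∈ g.lcs i) :
    g.bracket x y ∈ g.lcs (i + 1) :=
  Submodule.subset_span ⟨x, y, hy, rfl⟩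

theorem d_mem_lcs {i : ℕ} {x : g.carrier} (hx : x ∈ g.lcs i) : g.d x ∈ g.lcs i := by
  induction i generalizing x with
  | zero => exact Submodule.mem_top
  | succ i ih =>
    refine Submodule.span_le (p := (g.lcs (i + 1)).comap g.d).2 ?_ hx
    rintro _ ⟨x, y, hy, rfl⟩
    show g.d (g.bracket x y) ∈ g.lcs (i + 1)
    induction x using DirectSum.Decomposition.inductionOn g.deg with
    | zero => simp
    | add a b ha hb => rw [map_add, LinearMap.add_apply, map_add]; exact add_mem ha hb
    | homogeneous x =>
      rw [g.leibniz y x.2]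
      exact add_mem (g.bracket_mem_lcs _ hy)
        (Submodule.smul_mem _ _ (g.bracket_mem_lcs _ (ih hy)))

theorem Hom.map_mem_lcs {g : DGLieAlgebra.{u, w} k} {h : DGLieAlgebra.{u, v} k} (f : g.Hom h)
    {i : ℕ} {x : g.carrier} (hx : x ∈ g.lcs i) : f.toLinearMap x ∈ h.lcs i := by
  induction i generalizing x with
  | zero => exact Submodule.mem_top
  | succ i ih =>
    refine Submodule.span_le (p := (h.lcs (i + 1)).comap f.toLinearMap).2 ?_ hx
    rintro _ ⟨x, y, hy, rfl⟩
    show f.toLinearMap (g.bracket x y) ∈ h.lcs (i + 1)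
    rw [f.map_bracket]
    exact h.bracket_mem_lcs _ (ih hy)

/-- The `i`-th term of the lower central series, as a cochain complex. -/
def lcsComplex (i : ℕ) : CochainComplex (ModuleCat.{w} k) ℕ :=
  CochainComplex.of (fun n => ModuleCat.of k ↥(g.lcs i ⊓ g.deg n))
    (fun _ => ModuleCat.ofHom
      (g.d.restrict fun _ hx => ⟨g.d_mem_lcs hx.1, g.d_mem hx.2⟩))
    (fun _ => by
      refine ModuleCat.hom_ext (LinearMap.ext fun x => ?_)
      exact Subtype.ext (g.d_d x.1))

theorem lcsComplex_d (i n : ℕ) : (g.lcsComplex i).d n (n + 1) = ModuleCat.ofHom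
    (g.d.restrict (p := g.lcs i ⊓ g.deg n) (q := g.lcs i ⊓ g.deg (n + 1))
      fun _ hx => ⟨g.d_mem_lcs hx.1, g.d_mem hx.2⟩) :=
  CochainComplex.of_d (fun n => ModuleCat.of k ↥(g.lcs i ⊓ g.deg n))
    (fun _ => ModuleCat.ofHom (g.d.restrict fun _ hx => ⟨g.d_mem_lcs hx.1, g.d_mem hx.2⟩)) n

/-- The map induced by a morphism of dg Lie algebras on the `i`-th terms of the lower central
series. -/
def Hom.lcsMap {g h : DGLieAlgebra.{u, w} k} (f : g.Hom h) (i : ℕ) :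
    g.lcsComplex i ⟶ h.lcsComplex i :=
  CochainComplex.ofHom
    (fun _ => ModuleCat.ofHom
      (f.toLinearMap.restrict fun _ hx => ⟨f.map_mem_lcs hx.1, f.map_deg hx.2⟩))
    (fun _ => by
      rw [lcsComplex_d, lcsComplex_d]
      refine ModuleCat.hom_ext (LinearMap.ext fun x => ?_)
      exact Subtype.ext (f.map_d x.1).symm)

/-- A morphism of (nilpotent) dg Lie algebras is an acyclic fibration if it is surjective and
induces quasi-isomorphisms between the terms of the lower central series. -/
structure Hom.IsAcyclicFibration {g h : DGLieAlgebra.{u, w} k} (f : g.Hom h) : Prop where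
  surjective : Function.Surjective f.toLinearMap
  quasiIso : ∀ i, QuasiIso (f.lcsMap i)

end DGLieAlgebra

/-! ### Polynomial differential forms on simplices -/

namespace PolyForms

variable (k : Type u) [Field k] (ι : Type) [Fintype ι]

/-- The defining relations of `k[t_i, dt_i] / (∑ t_i - 1, ∑ dt_i)`, on the free associative algebra
with generators `t_i` (`Sum.inl i`) and `dt_i` (`Sum.inr i`): graded commutativity, with `t_i` of
degree `0` and `dt_i` of degree `1`, and the two linear relations. -/
inductive Rel : FreeAlgebra k (ι ⊕ ι) → FreeAlgebra k (ι ⊕ ι) → Prop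
  | t_t (i j : ι) : Rel
      (FreeAlgebra.ι k (Sum.inl i) * FreeAlgebra.ι k (Sum.inl j))
      (FreeAlgebra.ι k (Sum.inl j) * FreeAlgebra.ι k (Sum.inl i))
  | t_dt (i j : ι) : Rel
      (FreeAlgebra.ι k (Sum.inl i) * FreeAlgebra.ι k (Sum.inr j))
      (FreeAlgebra.ι k (Sum.inr j) * FreeAlgebra.ι k (Sum.inl i))
  | dt_dt (i j : ι) : Rel
      (FreeAlgebra.ι k (Sum.inr i) * FreeAlgebra.ι k (Sum.inr j))
      (-(FreeAlgebra.ι k (Sum.inr j) * FreeAlgebra.ι k (Sum.inr i)))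
  | dt_sq (i : ι) : Rel (FreeAlgebra.ι k (Sum.inr i) * FreeAlgebra.ι k (Sum.inr i)) 0
  | sum_t : Rel (∑ i, FreeAlgebra.ι k (Sum.inl i)) 1
  | sum_dt : Rel (∑ i, FreeAlgebra.ι k (Sum.inr i)) 0

end PolyForms

/-- The algebra `k[t_i, dt_i] / (∑ t_i - 1, ∑ dt_i)` of polynomial differential forms on the
simplex with set of vertices `ι`. -/
def PolyForms (k : Type u) [Field k] (ι : Type) [Fintype ι] : Type u :=
  RingQuot (PolyForms.Rel k ι)

namespace PolyForms

variable (k : Type u) [Field k] (ι : Type) [Fintype ι]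

instance : Ring (PolyForms k ι) := inferInstanceAs (Ring (RingQuot (PolyForms.Rel k ι)))

instance : Algebra k (PolyForms k ι) := inferInstanceAs (Algebra k (RingQuot (PolyForms.Rel k ι)))

variable {ι}

/-- The generators `t_i` and `dt_i`. -/
def gen (s : ι ⊕ ι) : PolyForms k ι :=
  RingQuot.mkAlgHom k (Rel k ι) (FreeAlgebra.ι k s)

/-- The barycentric coordinate `t_i`. -/
def t (i : ι) : PolyForms k ι := gen k (Sum.inl i)

/-- The differential `dt_i`. -/
def dt (i : ι) : PolyForms k ι := gen k (Sum.inr i)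

theorem t_mul_t (i j : ι) : t k i * t k j = t k j * t k i := by
  simpa only [map_mul] using! RingQuot.mkAlgHom_rel k (Rel.t_t (k := k) i j)

theorem t_mul_dt (i j : ι) : t k i * dt k j = dt k j * t k i := by
  simpa only [map_mul] using! RingQuot.mkAlgHom_rel k (Rel.t_dt (k := k) i j)

theorem dt_mul_dt (i j : ι) : dt k i * dt k j = -(dt k j * dt k i) := by
  simpa only [map_mul, map_neg] using! RingQuot.mkAlgHom_rel k (Rel.dt_dt (k := k) i j)

theorem dt_mul_self (i : ι) : dt k i * dt k i = 0 := by
  simpa only [map_mul, map_zero] using! RingQuot.mkAlgHom_rel k (Rel.dt_sq (k := k) i)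

variable (ι)

theorem sum_t : ∑ i : ι, t k i = 1 := by
  simpa only [map_sum, map_one] using! RingQuot.mkAlgHom_rel k (Rel.sum_t (k := k) (ι := ι))

theorem sum_dt : ∑ i : ι, dt k i = 0 := by
  simpa only [map_sum, map_zero] using! RingQuot.mkAlgHom_rel k (Rel.sum_dt (k := k) (ι := ι))

variable {k ι}

/-- The universal property of the algebra of polynomial differential forms. -/
def lift {B : Type*} [Ring B] [Algebra k B] (T DT : ι → B)
    (h1 : ∀ i j, T i * T j = T j * T i) (h2 : ∀ i j, T i * DT j = DT j * T i)
    (h3 : ∀ i j, DT i * DT j = -(DT j * DT i)) (h4 : ∀ i, DT i * DT i = 0)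
    (h5 : ∑ i, T i = 1) (h6 : ∑ i, DT i = 0) : PolyForms k ι →ₐ[k] B :=
  RingQuot.liftAlgHom k ⟨FreeAlgebra.lift k (Sum.elim T DT), by
    rintro _ _ (⟨i, j⟩ | ⟨i, j⟩ | ⟨i, j⟩ | ⟨i⟩ | _ | _)
    · simpa using h1 i j
    · simpa using h2 i j
    · simpa using h3 i j
    · simpa using h4 i
    · simpa using h5
    · simpa using h6⟩

section lift

variable {B : Type*} [Ring B] [Algebra k B] (T DT : ι → B)
    (h1 : ∀ i j, T i * T j = T j * T i) (h2 : ∀ i j, T i * DT j = DT j * T i)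
    (h3 : ∀ i j, DT i * DT j = -(DT j * DT i)) (h4 : ∀ i, DT i * DT i = 0)
    (h5 : ∑ i, T i = 1) (h6 : ∑ i, DT i = 0)

theorem lift_gen (s : ι ⊕ ι) : lift T DT h1 h2 h3 h4 h5 h6 (gen k s) = Sum.elim T DT s :=
  (RingQuot.liftAlgHom_mkAlgHom_apply k _ _ _).trans (FreeAlgebra.lift_ι_apply _ _)

theorem lift_t (i : ι) : lift T DT h1 h2 h3 h4 h5 h6 (t k i) = T i :=
  lift_gen T DT h1 h2 h3 h4 h5 h6 (Sum.inl i)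

theorem lift_dt (i : ι) : lift T DT h1 h2 h3 h4 h5 h6 (dt k i) = DT i :=
  lift_gen T DT h1 h2 h3 h4 h5 h6 (Sum.inr i)

end lift

theorem algHom_ext {B : Type*} [Ring B] [Algebra k B] {φ ψ : PolyForms k ι →ₐ[k] B}
    (ht : ∀ i, φ (t k i) = ψ (t k i)) (hdt : ∀ i, φ (dt k i) = ψ (dt k i)) : φ = ψ := by
  refine RingQuot.ringQuot_ext' k φ ψ (FreeAlgebra.hom_ext (funext ?_))
  rintro (i | i)
  · exact ht i
  · exact hdt i

variable (k ι)

/-- The forms of degree `p`: the span of the products of generators which contain exactly `p`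
factors `dt_i`. -/
def deg (p : ℕ) : Submodule k (PolyForms k ι) :=
  Submodule.span k {ω | ∃ s : List (ι ⊕ ι), s.countP Sum.isRight = p ∧ ω = (s.map (gen k)).prod}

variable {ι}

theorem word_mem_deg (s : List (ι ⊕ ι)) :
    (s.map (gen k)).prod ∈ deg k ι (s.countP Sum.isRight) :=
  Submodule.subset_span ⟨s, rfl, rfl⟩

theorem t_mem_deg (i : ι) : t k i ∈ deg k ι 0 :=
  Submodule.subset_span ⟨[Sum.inl i], by simp, by simp [t]⟩

theorem dt_mem_deg (i : ι) : dt k i ∈ deg k ι 1 :=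
  Submodule.subset_span ⟨[Sum.inr i], by simp, by simp [dt]⟩

variable (ι)

instance gradedMonoid : SetLike.GradedMonoid (deg k ι) where
  one_mem := Submodule.subset_span ⟨[], by simp, by simp⟩
  mul_mem := by
    intro p q a b ha hb
    refine Submodule.span_le (p := (deg k ι (p + q)).comap (LinearMap.mulRight k b)).2 ?_ ha
    rintro _ ⟨s, rfl, rfl⟩
    refine Submodule.span_le (p := (deg k ι (s.countP Sum.isRight + q)).comap
      (LinearMap.mulLeft k (s.map (gen k)).prod)).2 ?_ hb
    rintro _ ⟨s', rfl, rfl⟩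
    exact Submodule.subset_span ⟨s ++ s', by simp, by simp⟩

/-- The decomposition of a form into its homogeneous components, as a morphism of algebras. -/
def decomposeHom : PolyForms k ι →ₐ[k] ⨁ p, deg k ι p :=
  lift (fun i => DirectSum.of (fun p => deg k ι p) 0 ⟨t k i, t_mem_deg k i⟩)
    (fun i => DirectSum.of (fun p => deg k ι p) 1 ⟨dt k i, dt_mem_deg k i⟩)
    (fun i j => by
      rw [DirectSum.of_mul_of, DirectSum.of_mul_of]
      exact congrArg _ (Subtype.ext (t_mul_t k i j)))
    (fun i j => by
      rw [DirectSum.of_mul_of, DirectSum.of_mul_of]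
      exact DirectSum.of_eq_of_gradedMonoid_eq (Sigma.subtype_ext (add_comm _ _) (t_mul_dt k i j)))
    (fun i j => by
      rw [DirectSum.of_mul_of, DirectSum.of_mul_of, ← map_neg]
      exact congrArg _ (Subtype.ext (dt_mul_dt k i j)))
    (fun i => by
      rw [DirectSum.of_mul_of]
      exact (congrArg _ (Subtype.ext (dt_mul_self k i))).trans (map_zero _))
    (by
      rw [← map_sum]
      refine congrArg _ (Subtype.ext ?_)
      rw [AddSubmonoidClass.coe_finsetSum]
      exact sum_t k ι)
    (by
      rw [← map_sum]
      refine (congrArg _ (Subtype.ext ?_)).trans (map_zero _)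
      rw [AddSubmonoidClass.coe_finsetSum]
      exact sum_dt k ι)

theorem decomposeHom_word (s : List (ι ⊕ ι)) :
    decomposeHom k ι (s.map (gen k)).prod =
      DirectSum.of (fun p => deg k ι p) _ ⟨_, word_mem_deg k s⟩ := by
  induction s with
  | nil => exact map_one (decomposeHom k ι)
  | cons a s ih =>
    have e : ((a :: s).map (gen k)).prod = gen k a * (s.map (gen k)).prod := by simp
    refine (congrArg _ e).trans ?_
    rw [map_mul, ih]
    rcases a with i | i
    · rw [show decomposeHom k ι (gen k (Sum.inl i)) = _ from lift_t _ _ _ _ _ _ _ _ i,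
        DirectSum.of_mul_of]
      exact DirectSum.of_eq_of_gradedMonoid_eq (Sigma.subtype_ext
        (show 0 + s.countP Sum.isRight = (Sum.inl i :: s).countP Sum.isRight by simp) rfl)
    · rw [show decomposeHom k ι (gen k (Sum.inr i)) = _ from lift_dt _ _ _ _ _ _ _ _ i,
        DirectSum.of_mul_of]
      exact DirectSum.of_eq_of_gradedMonoid_eq (Sigma.subtype_ext
        (show 1 + s.countP Sum.isRight = (Sum.inr i :: s).countP Sum.isRight by
          rw [List.countP_cons_of_pos (by rfl), add_comm]) rfl)

instance gradedAlgebra : GradedAlgebra (deg k ι) :=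
  GradedAlgebra.ofAlgHom (deg k ι) (decomposeHom k ι)
    (algHom_ext
      (fun i => by
        rw [AlgHom.comp_apply, decomposeHom, lift_t]
        exact DirectSum.coeAlgHom_of _ _ _)
      (fun i => by
        rw [AlgHom.comp_apply, decomposeHom, lift_dt]
        exact DirectSum.coeAlgHom_of _ _ _))
    (by
      rintro p ⟨ω, hω⟩
      show decomposeHom k ι ω = _
      induction hω using Submodule.span_induction with
      | mem ω h =>
        obtain ⟨s, rfl, rfl⟩ := h
        exact decomposeHom_word k ι s
      | zero => rw [map_zero]; exact (map_zero _).symm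
      | add a b ha hb iha ihb => rw [map_add, iha, ihb, ← map_add]; rfl
      | smul r a ha iha =>
        rw [map_smul, iha]
        exact (map_smul (DirectSum.lof k ℕ (fun p => deg k ι p) p) r ⟨a, ha⟩).symm)

variable {k ι} in
/-- Linear maps agree on forms once they agree on all products of generators. -/
theorem linearMap_ext {U : Type*} [AddCommGroup U] [Module k U] {f g : PolyForms k ι →ₗ[k] U}
    (h : ∀ s : List (ι ⊕ ι), f (s.map (gen k)).prod = g (s.map (gen k)).prod) : f = g := by
  refine DirectSum.decompose_lhom_ext (deg k ι) fun p => LinearMap.ext fun ω => ?_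
  refine LinearMap.eqOn_span (f := f) (g := g) ?_ ω.2
  rintro _ ⟨s, -, rfl⟩
  exact h s

/-- The sign involution, as a morphism of algebras: `t_i ↦ t_i` and `dt_i ↦ -dt_i`. -/
def sgn : PolyForms k ι →ₐ[k] PolyForms k ι :=
  lift (t k) (fun i => -dt k i) (t_mul_t k)
    (fun i j => by rw [mul_neg, neg_mul, t_mul_dt])
    (fun i j => by rw [neg_mul_neg, neg_mul_neg, dt_mul_dt])
    (fun i => by rw [neg_mul_neg, dt_mul_self])
    (sum_t k ι) (by rw [Finset.sum_neg_distrib, sum_dt, neg_zero])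

/-- The morphism of algebras `ω ↦ !![sgn ω, dω; 0, ω]` whose upper right entry is the de Rham
differential: the derivation with `d t_i = dt_i`, `d dt_i = 0` and
`d (a * b) = da * b + (-1) ^ |a| a * db`. -/
def dHom : PolyForms k ι →ₐ[k] Matrix (Fin 2) (Fin 2) (PolyForms k ι) :=
  lift (fun i => !![t k i, dt k i; 0, t k i]) (fun i => !![-dt k i, 0; 0, dt k i])
    (fun i j => by
      rw [Matrix.mul_fin_two, Matrix.mul_fin_two]
      simp [t_mul_t k i j, t_mul_dt, add_comm])
    (fun i j => by
      rw [Matrix.mul_fin_two, Matrix.mul_fin_two]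
      simp [t_mul_dt, dt_mul_dt k i j])
    (fun i j => by
      rw [Matrix.mul_fin_two, Matrix.mul_fin_two]
      ext a b
      fin_cases a <;> fin_cases b <;> simp [dt_mul_dt k i j])
    (fun i => by
      rw [Matrix.mul_fin_two]
      ext a b
      fin_cases a <;> fin_cases b <;> simp [dt_mul_self])
    (by
      ext a b
      fin_cases a <;> fin_cases b <;> simp [Matrix.sum_apply, sum_t, sum_dt])
    (by
      ext a b
      fin_cases a <;> fin_cases b <;> simp [Matrix.sum_apply, sum_dt])

/-- The de Rham differential. -/
def d : PolyForms k ι →ₗ[k] PolyForms k ι :=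
  Matrix.entryLinearMap k (PolyForms k ι) 0 1 ∘ₗ (dHom k ι).toLinearMap

theorem dHom_eq (ω : PolyForms k ι) : dHom k ι ω = !![sgn k ι ω, d k ι ω; 0, ω] := by
  have h00 : ∀ ω, dHom k ι ω 1 0 = 0 := by
    intro ω
    refine LinearMap.congr_fun (f := Matrix.entryLinearMap k (PolyForms k ι) 1 0 ∘ₗ
      (dHom k ι).toLinearMap) (g := 0) (linearMap_ext fun s => ?_) ω
    show dHom k ι _ 1 0 = 0
    induction s with
    | nil => simp
    | cons a s ih =>
      rw [List.map_cons, List.prod_cons, map_mul, Matrix.mul_apply, Fin.sum_univ_two, ih]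
      have : dHom k ι (gen k a) 1 0 = 0 := by
        rw [dHom, lift_gen]
        rcases a with i | i <;> simp
      simp [this]
  have h11 : ∀ ω, dHom k ι ω 1 1 = ω := by
    intro ω
    refine LinearMap.congr_fun (f := Matrix.entryLinearMap k (PolyForms k ι) 1 1 ∘ₗ
      (dHom k ι).toLinearMap) (g := LinearMap.id) (linearMap_ext fun s => ?_) ω
    show dHom k ι _ 1 1 = (s.map (gen k)).prod
    induction s with
    | nil => simp
    | cons a s ih =>
      rw [List.map_cons, List.prod_cons, map_mul, Matrix.mul_apply, Fin.sum_univ_two, ih]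
      have : dHom k ι (gen k a) 1 1 = gen k a := by
        rw [dHom, lift_gen]
        rcases a with i | i <;> simp [t, dt]
      simp [this, h00]
  have h0 : ∀ ω, dHom k ι ω 0 0 = sgn k ι ω := by
    intro ω
    refine LinearMap.congr_fun (f := Matrix.entryLinearMap k (PolyForms k ι) 0 0 ∘ₗ
      (dHom k ι).toLinearMap) (g := (sgn k ι).toLinearMap) (linearMap_ext fun s => ?_) ω
    show dHom k ι _ 0 0 = sgn k ι _
    induction s with
    | nil => simp
    | cons a s ih =>
      rw [List.map_cons, List.prod_cons, map_mul, map_mul, Matrix.mul_apply, Fin.sum_univ_two, ih]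
      have : dHom k ι (gen k a) 0 0 = sgn k ι (gen k a) := by
        rw [dHom, sgn, lift_gen, lift_gen]
        rcases a with i | i <;> simp
      simp [this, h00]
  ext a b
  fin_cases a <;> fin_cases b
  · exact h0 ω
  · rfl
  · exact h00 ω
  · exact h11 ω

theorem d_mul (a b : PolyForms k ι) :
    d k ι (a * b) = d k ι a * b + sgn k ι a * d k ι b := by
  show dHom k ι (a * b) 0 1 = _
  rw [map_mul, dHom_eq, dHom_eq, Matrix.mul_fin_two]
  simp [add_comm]

variable {ι}

theorem sgn_t (i : ι) : sgn k ι (t k i) = t k i := lift_t _ _ _ _ _ _ _ _ i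

theorem sgn_dt (i : ι) : sgn k ι (dt k i) = -dt k i := lift_dt _ _ _ _ _ _ _ _ i

theorem d_t (i : ι) : d k ι (t k i) = dt k i := by
  show dHom k ι (t k i) 0 1 = _
  rw [dHom, lift_t]
  simp

theorem d_dt (i : ι) : d k ι (dt k i) = 0 := by
  show dHom k ι (dt k i) 0 1 = _
  rw [dHom, lift_dt]
  simp

variable (ι)

theorem d_one : d k ι 1 = 0 := by
  show dHom k ι 1 0 1 = _
  simp

variable {k ι}

theorem sgn_of_mem {p : ℕ} {ω : PolyForms k ι} (hω : ω ∈ deg k ι p) :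
    sgn k ι ω = (-1 : k) ^ p • ω := by
  refine LinearMap.eqOn_span (f := (sgn k ι).toLinearMap)
    (g := (-1 : k) ^ p • (LinearMap.id : PolyForms k ι →ₗ[k] PolyForms k ι)) ?_ hω
  rintro _ ⟨s, rfl, rfl⟩
  show sgn k ι (s.map (gen k)).prod = (-1 : k) ^ (s.countP Sum.isRight) • (s.map (gen k)).prod
  clear hω
  induction s with
  | nil => simp
  | cons a s ih =>
    rw [List.map_cons, List.prod_cons, map_mul, ih, List.countP_cons]
    rcases a with i | i
    · rw [show sgn k ι (gen k (Sum.inl i)) = gen k (Sum.inl i) from sgn_t k i]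
      simp
    · rw [show sgn k ι (gen k (Sum.inr i)) = -gen k (Sum.inr i) from sgn_dt k i]
      simp [pow_succ]

theorem d_mem {p : ℕ} {ω : PolyForms k ι} (hω : ω ∈ deg k ι p) : d k ι ω ∈ deg k ι (p + 1) := by
  refine Submodule.span_le (p := (deg k ι (p + 1)).comap (d k ι)).2 ?_ hω
  rintro _ ⟨s, rfl, rfl⟩
  show d k ι (s.map (gen k)).prod ∈ deg k ι (s.countP Sum.isRight + 1)
  clear hω
  induction s with
  | nil => simp [d_one]
  | cons a s ih =>
    rw [List.map_cons, List.prod_cons, List.countP_cons, d_mul]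
    rcases a with i | i
    · refine add_mem ?_ ?_
      · rw [show d k ι (gen k (Sum.inl i)) = dt k i from d_t k i]
        have := SetLike.mul_mem_graded (dt_mem_deg k i) (word_mem_deg k s)
        rwa [add_comm] at this
      · rw [show sgn k ι (gen k (Sum.inl i)) = t k i from sgn_t k i]
        have := SetLike.mul_mem_graded (t_mem_deg k i) ih
        rwa [zero_add] at this
    · rw [show d k ι (gen k (Sum.inr i)) = 0 from d_dt k i,
        show sgn k ι (gen k (Sum.inr i)) = -dt k i from sgn_dt k i, zero_mul, zero_add, neg_mul]
      have := SetLike.mul_mem_graded (dt_mem_deg k i) ih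
      rw [add_comm] at this
      exact neg_mem this

theorem d_d (ω : PolyForms k ι) : d k ι (d k ι ω) = 0 := by
  refine LinearMap.congr_fun (f := d k ι ∘ₗ d k ι) (g := 0) (linearMap_ext fun s => ?_) ω
  show d k ι (d k ι (s.map (gen k)).prod) = 0
  induction s with
  | nil => simp [d_one]
  | cons a s ih =>
    rw [List.map_cons, List.prod_cons]
    rcases a with i | i
    · rw [show gen k (Sum.inl i) = t k i from rfl]
      simp [d_mul, d_t, d_dt, sgn_t, sgn_dt, ih]
    · rw [show gen k (Sum.inr i) = dt k i from rfl]
      simp [d_mul, d_dt, sgn_dt, ih]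

theorem leibniz {p : ℕ} {a : PolyForms k ι} (b : PolyForms k ι) (ha : a ∈ deg k ι p) :
    d k ι (a * b) = d k ι a * b + (-1 : k) ^ p • (a * d k ι b) := by
  rw [d_mul, sgn_of_mem ha, smul_mul_assoc]

theorem t_mul (i : ι) (b : PolyForms k ι) : t k i * b = b * t k i := by
  refine LinearMap.congr_fun (f := LinearMap.mulLeft k (t k i))
    (g := LinearMap.mulRight k (t k i)) (linearMap_ext fun s => ?_) b
  show t k i * (s.map (gen k)).prod = (s.map (gen k)).prod * t k i
  induction s with
  | nil => simp
  | cons a s ih =>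
    rw [List.map_cons, List.prod_cons, mul_assoc, ← ih, ← mul_assoc, ← mul_assoc]
    congr 1
    rcases a with j | j
    · exact t_mul_t k i j
    · exact t_mul_dt k i j

theorem dt_mul (i : ι) (b : PolyForms k ι) : dt k i * b = sgn k ι b * dt k i := by
  refine LinearMap.congr_fun (f := LinearMap.mulLeft k (dt k i))
    (g := LinearMap.mulRight k (dt k i) ∘ₗ (sgn k ι).toLinearMap) (linearMap_ext fun s => ?_) b
  show dt k i * (s.map (gen k)).prod = sgn k ι (s.map (gen k)).prod * dt k i
  induction s with
  | nil => simp
  | cons a s ih =>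
    rw [List.map_cons, List.prod_cons, map_mul, mul_assoc, ← ih, ← mul_assoc, ← mul_assoc]
    congr 1
    rcases a with j | j
    · rw [show gen k (Sum.inl j) = t k j from rfl, sgn_t, t_mul_dt]
    · rw [show gen k (Sum.inr j) = dt k j from rfl, sgn_dt, dt_mul_dt, neg_mul]

theorem comm {m n : ℕ} {a b : PolyForms k ι} (ha : a ∈ deg k ι m) (hb : b ∈ deg k ι n) :
    a * b = (-1 : k) ^ (m * n) • (b * a) := by
  refine LinearMap.eqOn_span (f := LinearMap.mulRight k b)
    (g := (-1 : k) ^ (m * n) • LinearMap.mulLeft k b) ?_ ha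
  rintro _ ⟨s, rfl, rfl⟩
  show (s.map (gen k)).prod * b =
    (-1 : k) ^ (s.countP Sum.isRight * n) • (b * (s.map (gen k)).prod)
  clear ha
  induction s with
  | nil => simp
  | cons a s ih =>
    rw [List.map_cons, List.prod_cons, List.countP_cons, mul_assoc, ih, mul_smul_comm,
      ← mul_assoc, ← mul_assoc]
    rcases a with i | i
    · rw [show gen k (Sum.inl i) = t k i from rfl, t_mul]
      simp
    · rw [show gen k (Sum.inr i) = dt k i from rfl, dt_mul, sgn_of_mem hb]
      simp [add_mul, pow_add, smul_smul]

/-- The commutative dg algebra of polynomial differential forms on the simplex with set of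
vertices `ι`. -/
def cdga (k : Type u) [Field k] (ι : Type) [Fintype ι] : CommDGAlgebra.{u, u} k where
  carrier := PolyForms k ι
  deg := deg k ι
  d := d k ι
  d_mem := d_mem
  d_d := d_d
  leibniz := leibniz
  comm := comm

variable {κ : Type} [Fintype κ] [DecidableEq ι]

theorem sum_dt_mul_self (s : Finset κ) : (∑ j ∈ s, dt k j) * (∑ j ∈ s, dt k j) = 0 := by
  classical
  induction s using Finset.induction_on with
  | empty => simp
  | insert a s ha ih =>
    have e : dt k a * (∑ j ∈ s, dt k j) = -((∑ j ∈ s, dt k j) * dt k a) := by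
      rw [Finset.mul_sum, Finset.sum_mul, ← Finset.sum_neg_distrib]
      exact Finset.sum_congr rfl fun j _ => dt_mul_dt k a j
    rw [Finset.sum_insert ha, add_mul, mul_add, mul_add, ih, dt_mul_self, e]
    simp

variable (k) in
/-- The pullback of forms along the affine map of simplices given by a map `u` of vertices:
`t_i ↦ ∑_{u j = i} t_j` and `dt_i ↦ ∑_{u j = i} dt_j`. -/
def pullback (u : κ → ι) : PolyForms k ι →ₐ[k] PolyForms k κ :=
  lift (fun i => ∑ j with u j = i, t k j) (fun i => ∑ j with u j = i, dt k j)
    (fun i i' => by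
      rw [Finset.sum_mul_sum, Finset.sum_mul_sum, Finset.sum_comm]
      exact Finset.sum_congr rfl fun j _ => Finset.sum_congr rfl fun j' _ => t_mul_t k j' j)
    (fun i i' => by
      rw [Finset.sum_mul_sum, Finset.sum_mul_sum, Finset.sum_comm]
      exact Finset.sum_congr rfl fun j _ => Finset.sum_congr rfl fun j' _ => t_mul_dt k j' j)
    (fun i i' => by
      rw [Finset.sum_mul_sum, Finset.sum_mul_sum, Finset.sum_comm, ← Finset.sum_neg_distrib]
      refine Finset.sum_congr rfl fun j _ => ?_
      rw [← Finset.sum_neg_distrib]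
      exact Finset.sum_congr rfl fun j' _ => dt_mul_dt k j' j)
    (fun i => sum_dt_mul_self _)
    (by rw [Finset.sum_fiberwise]; exact sum_t k κ)
    (by rw [Finset.sum_fiberwise]; exact sum_dt k κ)

theorem pullback_t (u : κ → ι) (i : ι) : pullback k u (t k i) = ∑ j with u j = i, t k j :=
  lift_t _ _ _ _ _ _ _ _ i

theorem pullback_dt (u : κ → ι) (i : ι) : pullback k u (dt k i) = ∑ j with u j = i, dt k j :=
  lift_dt _ _ _ _ _ _ _ _ i

theorem pullback_mem (u : κ → ι) {p : ℕ} {ω : PolyForms k ι} (hω : ω ∈ deg k ι p) :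
    pullback k u ω ∈ deg k κ p := by
  refine Submodule.span_le (p := (deg k κ p).comap (pullback k u).toLinearMap).2 ?_ hω
  rintro _ ⟨s, rfl, rfl⟩
  show pullback k u (s.map (gen k)).prod ∈ deg k κ (s.countP Sum.isRight)
  clear hω
  induction s with
  | nil => simpa using (SetLike.GradedOne.one_mem : (1 : PolyForms k κ) ∈ deg k κ 0)
  | cons a s ih =>
    rw [List.map_cons, List.prod_cons, List.countP_cons, map_mul, add_comm]
    refine SetLike.mul_mem_graded ?_ ih
    rcases a with i | i
    · rw [show gen k (Sum.inl i) = t k i from rfl, pullback_t]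
      exact sum_mem fun j _ => t_mem_deg k j
    · rw [show gen k (Sum.inr i) = dt k i from rfl, pullback_dt]
      exact sum_mem fun j _ => dt_mem_deg k j

theorem pullback_d (u : κ → ι) (ω : PolyForms k ι) :
    pullback k u (d k ι ω) = d k κ (pullback k u ω) := by
  refine LinearMap.congr_fun (f := (pullback k u).toLinearMap ∘ₗ d k ι)
    (g := d k κ ∘ₗ (pullback k u).toLinearMap) (linearMap_ext fun s => ?_) ω
  show pullback k u (d k ι (s.map (gen k)).prod) = d k κ (pullback k u (s.map (gen k)).prod)
  have hs : ∀ ω, pullback k u (sgn k ι ω) = sgn k κ (pullback k u ω) := by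
    intro ω
    refine AlgHom.congr_fun (φ₁ := (pullback k u).comp (sgn k ι))
      (φ₂ := (sgn k κ).comp (pullback k u)) (algHom_ext (fun i => ?_) (fun i => ?_)) ω
    · simp [sgn_t, pullback_t]
    · simp [sgn_dt, pullback_dt]
  induction s with
  | nil => simp [d_one]
  | cons a s ih =>
    rw [List.map_cons, List.prod_cons, map_mul (pullback k u), d_mul, d_mul, map_add,
      map_mul (pullback k u), map_mul (pullback k u), ih, hs]
    congr 2
    rcases a with i | i
    · rw [show gen k (Sum.inl i) = t k i from rfl]
      simp [pullback_t, pullback_dt, d_t]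
    · rw [show gen k (Sum.inr i) = dt k i from rfl]
      simp [pullback_dt, d_dt]

/-- The pullback of forms, as a morphism of commutative dg algebras. -/
def pullbackHom (k : Type u) [Field k] (u : κ → ι) : (cdga k ι).Hom (cdga k κ) where
  toAlgHom := pullback k u
  map_deg := pullback_mem u
  map_d := pullback_d u

theorem pullback_id : pullback k (id : ι → ι) = AlgHom.id k _ :=
  algHom_ext (fun i => by simp [pullback_t, Finset.filter_eq'])
    (fun i => by simp [pullback_dt, Finset.filter_eq'])

theorem pullback_comp {μ : Type} [Fintype μ] [DecidableEq κ] (u : κ → ι) (v : μ → κ) :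
    pullback k (u ∘ v) = (pullback k v).comp (pullback k u) := by
  have key : ∀ (i : ι) (F : μ → PolyForms k μ),
      ∑ m with u (v m) = i, F m = ∑ j with u j = i, ∑ m with v m = j, F m := by
    intro i F
    simp only [Finset.sum_filter]
    rw [← Finset.sum_fiberwise (s := Finset.univ) (g := v)]
    refine Finset.sum_congr rfl fun j _ => ?_
    rw [Finset.sum_filter]
    split_ifs with h
    · exact Finset.sum_congr rfl fun m _ => by split_ifs <;> simp_all
    · exact Finset.sum_eq_zero fun m _ => by split_ifs <;> simp_all
  refine algHom_ext (fun i => ?_) (fun i => ?_)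
  · simp only [AlgHom.comp_apply, pullback_t, map_sum, Function.comp_apply, key]
  · simp only [AlgHom.comp_apply, pullback_dt, map_sum, Function.comp_apply, key]

end PolyForms

/-! ### The contents of a dg Lie algebra -/

namespace DGLieAlgebra

open Opposite

variable {k : Type u} [Field k]

/-- The identity morphism. -/
def _root_.CommDGAlgebra.Hom.id (A : CommDGAlgebra.{u, v} k) : A.Hom A where
  toAlgHom := AlgHom.id k A.carrier
  map_deg ha := ha
  map_d _ := rfl

/-- The identity morphism. -/
def Hom.id (g : DGLieAlgebra.{u, v} k) : g.Hom g where
  toLinearMap := LinearMap.id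
  map_deg hx := hx
  map_d _ := rfl
  map_bracket _ _ := rfl

/-- The dg Lie algebra `Ω_n ⊗ g`, where `Ω_n` is the algebra of polynomial differential forms on
the standard `n`-simplex. -/
abbrev forms (g : DGLieAlgebra.{u, v} k) (n : ℕ) : DGLieAlgebra.{u, max u v} k :=
  tensor (PolyForms.cdga k (Fin (n + 1))) g

/-- The action of a map `u` of vertices on Maurer--Cartan elements of `Ω_q ⊗ g`. -/
def pullbackMC (g : DGLieAlgebra.{u, v} k) {p q : ℕ} (u : Fin (p + 1) → Fin (q + 1))
    (x : (g.forms q).MC) : (g.forms p).MC :=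
  ⟨_, (tensorMap (PolyForms.pullbackHom k u) (Hom.id g)).map_mem_MC x.2⟩

/-- The action of a morphism of dg Lie algebras `f : g → h` on Maurer--Cartan elements of
`Ω_n ⊗ g`. -/
def Hom.mapMC {g h : DGLieAlgebra.{u, v} k} (f : g.Hom h) (n : ℕ) (x : (g.forms n).MC) :
    (h.forms n).MC :=
  ⟨_, (tensorMap (CommDGAlgebra.Hom.id (PolyForms.cdga k (Fin (n + 1)))) f).map_mem_MC x.2⟩

theorem pullbackMC_id (g : DGLieAlgebra.{u, v} k) {p : ℕ} (x : (g.forms p).MC) :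
    g.pullbackMC (fun i => i) x = x := by
  refine Subtype.ext ?_
  have h : TensorProduct.map (PolyForms.pullback k (id : Fin (p + 1) → _)).toLinearMap
      (LinearMap.id : g.carrier →ₗ[k] g.carrier) = LinearMap.id := by
    rw [PolyForms.pullback_id]
    exact TensorProduct.map_id
  exact LinearMap.congr_fun h x.1

theorem pullbackMC_comp (g : DGLieAlgebra.{u, v} k) {p q r : ℕ} (u : Fin (q + 1) → Fin (r + 1))
    (u' : Fin (p + 1) → Fin (q + 1)) (x : (g.forms r).MC) :
    g.pullbackMC (fun i => u (u' i)) x = g.pullbackMC u' (g.pullbackMC u x) := by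
  refine Subtype.ext ?_
  have h : TensorProduct.map (PolyForms.pullback k (u ∘ u')).toLinearMap
      (LinearMap.id : g.carrier →ₗ[k] g.carrier) =
      TensorProduct.map (PolyForms.pullback k u').toLinearMap LinearMap.id ∘ₗ
        TensorProduct.map (PolyForms.pullback k u).toLinearMap LinearMap.id := by
    rw [PolyForms.pullback_comp, ← TensorProduct.map_comp]
    rfl
  exact LinearMap.congr_fun h x.1

theorem Hom.mapMC_pullbackMC {g h : DGLieAlgebra.{u, v} k} (f : g.Hom h) {p q : ℕ}
    (u : Fin (p + 1) → Fin (q + 1)) (x : (g.forms q).MC) :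
    f.mapMC p (g.pullbackMC u x) = h.pullbackMC u (f.mapMC q x) := by
  refine Subtype.ext ?_
  have h : TensorProduct.map LinearMap.id f.toLinearMap ∘ₗ
        TensorProduct.map (PolyForms.pullback k u).toLinearMap LinearMap.id =
      TensorProduct.map (PolyForms.pullback k u).toLinearMap LinearMap.id ∘ₗ
        TensorProduct.map LinearMap.id f.toLinearMap := by
    rw [← TensorProduct.map_comp, ← TensorProduct.map_comp]
    rfl
  exact LinearMap.congr_fun h x.1

/-- The contents `Σ(g) = MC(Ω_• ⊗ g)` of a dg Lie algebra `g`: the simplicial set whose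
`n`-simplices are the Maurer--Cartan elements of `Ω_n ⊗ g`. -/
def contents (g : DGLieAlgebra.{u, v} k) : SSet.{max u v} where
  obj n := (g.forms n.unop.len).MC
  map θ := ↾fun x => g.pullbackMC θ.unop.toOrderHom x
  map_id _ := by
    refine ConcreteCategory.hom_ext _ _ fun x => ?_
    exact g.pullbackMC_id x
  map_comp θ η := by
    refine ConcreteCategory.hom_ext _ _ fun x => ?_
    exact g.pullbackMC_comp θ.unop.toOrderHom η.unop.toOrderHom x

/-- The map `Σ(f) : Σ(g) → Σ(h)` induced by a morphism of dg Lie algebras. -/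
def Hom.contentsMap {g h : DGLieAlgebra.{u, v} k} (f : g.Hom h) : g.contents ⟶ h.contents where
  app n := ↾fun x => f.mapMC n.unop.len x
  naturality _ _ θ := by
    refine ConcreteCategory.hom_ext _ _ fun x => ?_
    exact f.mapMC_pullbackMC θ.unop.toOrderHom x

end DGLieAlgebra

/-! ### Acyclic fibrations of simplicial sets -/

namespace SSet

open MonoidalCategory Simplicial

/-- The set of homotopy classes of maps of simplicial sets: the quotient of `X ⟶ Z` by the
equivalence relation generated by simplicial homotopy. -/
def HomotopyClasses (X Z : SSet.{u}) : Type u :=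
  Quot (fun f g : X ⟶ Z => Nonempty (SSet.Homotopy f g))

/-- Precomposition of homotopy classes with a map of simplicial sets. -/
def HomotopyClasses.precomp {X Y : SSet.{u}} (p : X ⟶ Y) (Z : SSet.{u}) :
    HomotopyClasses Y Z → HomotopyClasses X Z :=
  Quot.map (fun f => p ≫ f) (fun f g ⟨H⟩ => ⟨
    { h := p ▷ Δ[1] ≫ H.h
      h₀ := by
        have : ι₀ ≫ p ▷ Δ[1] ≫ H.h = p ≫ ι₀ ≫ H.h := rfl
        rw [this, H.h₀]; rfl
      h₁ := by
        have : ι₁ ≫ p ▷ Δ[1] ≫ H.h = p ≫ ι₁ ≫ H.h := rfl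
        rw [this, H.h₁]; rfl
      rel := by
        ext n ⟨x, y⟩
        exact x.2.elim }⟩)

/-- A map of simplicial sets `p : X ⟶ Y` is a weak homotopy equivalence if it induces a bijection
`[Y, Z] → [X, Z]` between sets of homotopy classes of maps, for every Kan complex `Z`. -/
def IsWeakHomotopyEquivalence {X Y : SSet.{u}} (p : X ⟶ Y) : Prop :=
  ∀ Z : SSet.{u}, SSet.KanComplex Z → Function.Bijective (HomotopyClasses.precomp p Z)

open modelCategoryQuillen HomotopicalAlgebra in
/-- An acyclic fibration of simplicial sets is a Kan fibration which is a weak homotopy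
equivalence. -/
structure IsAcyclicFibration {X Y : SSet.{u}} (p : X ⟶ Y) : Prop where
  fibration : Fibration p
  weakEquivalence : IsWeakHomotopyEquivalence p

end SSet

end

noncomputable section

/-! ### Extension of boundary data in simplicial modules over the coordinate functions -/

/-! A map with the right lifting property against the inclusions `∂Δ[n] → Δ[n]` has it against all
monomorphisms. It is then a Kan fibration, because horn inclusions are monomorphisms, and a homotopy
equivalence, because it lifts against `∅ → Y` and `X ⊔ X → X × Δ[1]`. So the problem is to lift a
Maurer–Cartan element `y` of `Ω_{n+1} ⊗ h` to one of `Ω_{n+1} ⊗ g` with prescribed Maurer–Cartan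
faces, and to lift vertices.

Without the Maurer–Cartan equation this is linear. A graded linear section of `f` lifts `y` to a
form `y'` of degree one. The errors on the faces are compatible forms with values in `ker f`, and
they extend to the whole simplex (`CoordModule.exists_extension`): degeneracies repair all faces but
one, as in any simplicial group, and the partition of unity `∑ t_i = 1` repairs the last. The result
is some `x` of degree one with the right image and the right boundary.

The curvature `R = dx + ½[x,x]` is killed by `f` and by restriction to the boundary, hence lies in
`B ⊗ ker f`, where `B` is the ideal of forms vanishing on the boundary (`Hom.mem_tensorSub`).
Changing `x` by an element of `B ⊗ ker f` affects neither the image nor the boundary. Filter this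
space by `B ⊗ J_i` with `J_i = ker f ∩ lcs i`. Brackets with any element raise `i`. Each `J_i` is
acyclic, since `f` is a surjective quasi-isomorphism on `lcs i`; over a field it is therefore
contractible, and the contraction passes to `B ⊗ J_i` with no knowledge of the cohomology of forms
(`Hom.IsAcyclicFibration.exists_contraction`, `Contraction.acyclicFiltration`).

Obstruction theory concludes (`AcyclicFiltration.exists_MC`): if `R` lies in the `i`-th term, the
Bianchi identity `dR = -[x,R]` makes it closed modulo the next term, hence exact modulo that term,
and subtracting a primitive from `x` moves the curvature into the next term. Nilpotence of `g` makes
the process stop at curvature zero. -/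

/-- A simplicial abelian group with an additive action of the barycentric coordinates `t_i`. -/
structure CoordModule where
  obj : ℕ → Type v
  [addCommGroup : ∀ n, AddCommGroup (obj n)]
  act : ∀ {p q : ℕ}, (SimplexCategory.mk p ⟶ SimplexCategory.mk q) → obj q →+ obj p
  act_id : ∀ {n : ℕ} (x : obj n), act (𝟙 _) x = x
  act_comp : ∀ {p q r : ℕ} (a : SimplexCategory.mk p ⟶ SimplexCategory.mk q)
    (b : SimplexCategory.mk q ⟶ SimplexCategory.mk r) (x : obj r), act (a ≫ b) x = act a (act b x)
  coord : ∀ {n : ℕ}, Fin (n + 1) → obj n →+ obj n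
  act_coord : ∀ {p q : ℕ} (a : SimplexCategory.mk p ⟶ SimplexCategory.mk q) (i : Fin (q + 1))
    (x : obj q), act a (coord i x) = ∑ j with a.toOrderHom j = i, coord j (act a x)
  sum_coord : ∀ {n : ℕ} (x : obj n), ∑ i, coord i x = x

attribute [instance] CoordModule.addCommGroup

namespace CoordModule

open SimplexCategory

variable (M : CoordModule.{v})

/-- A family of subgroups stable under the simplicial operators and the coordinates. -/
structure IsStable (P : ∀ n, AddSubgroup (M.obj n)) : Prop where
  act_mem : ∀ {p q : ℕ} (a : SimplexCategory.mk p ⟶ SimplexCategory.mk q) {x : M.obj q},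
    x ∈ P q → M.act a x ∈ P p
  coord_mem : ∀ {n : ℕ} (i : Fin (n + 1)) {x : M.obj n}, x ∈ P n → M.coord i x ∈ P n

/-- The prism operator, which contracts the elements with vanishing boundary. -/
def prism {n : ℕ} (w : M.obj n) : M.obj (n + 1) :=
  ∑ j : Fin (n + 1), (-1 : ℤ) ^ (j : ℕ) •
    ∑ i : Fin (n + 2) with j.castSucc < i, M.coord i (M.act (σ j) w)

variable {M}

/-- By the simplicial identities `δ l ≫ σ j` is the identity if `l` is `j` or `j + 1`, and otherwise
factors through dimension `n - 1`, where `w` vanishes. For `n = 0` the second case does not occur.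
-/
theorem act_δ_σ {n : ℕ} {w : M.obj n}
    (hw : ∀ (m : ℕ) (a : SimplexCategory.mk m ⟶ SimplexCategory.mk n), m < n → M.act a w = 0)
    (l : Fin (n + 2)) (j : Fin (n + 1)) :
    M.act (δ l) (M.act (σ j) w) = if l = j.castSucc ∨ l = j.succ then w else 0 := by
  rw [← M.act_comp]
  split_ifs with h
  · rcases h with rfl | rfl
    · rw [δ_comp_σ_self, M.act_id]
    · rw [δ_comp_σ_succ, M.act_id]
  · rw [not_or] at h
    obtain _ | n := n
    · exfalso
      have h1 := h.1
      have h2 := h.2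
      rw [Fin.ext_iff] at h1 h2
      simp at h1 h2
      omega
    · rcases lt_or_gt_of_ne h.1 with h1 | h1
      · obtain ⟨j, rfl⟩ := Fin.exists_succ_eq.2 (show j ≠ 0 by
          rintro rfl; exact absurd h1 (by simp))
        obtain ⟨l, rfl⟩ := Fin.exists_castSucc_eq.2 (show l ≠ Fin.last _ by
          rintro rfl; exact absurd h1 (by simp [Fin.le_last]))
        rw [δ_comp_σ_of_le (by
          rw [Fin.lt_def] at h1; rw [Fin.le_def]; simp at h1 ⊢; omega), M.act_comp,
          hw _ _ (by omega), map_zero]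
      · have h2 : j.succ < l := by
          have h2 := h.2
          rw [Fin.ext_iff] at h2; rw [Fin.lt_def] at h1 ⊢
          simp at h1 h2 ⊢; omega
        rw [δ_comp_σ_of_gt' h2, M.act_comp, hw _ _ (by omega), map_zero]

/-- Only the terms with `l = j` or `l = j + 1` survive. On face `0` this leaves `j = 0`, with
coefficient `∑ t_a = 1`. On face `b + 1` the terms `j = b` and `j = b + 1` both become `∑_{a > b}
t_a w`, with opposite signs; on the last face there is one term, and its sum is empty. -/
theorem act_δ_prism {n : ℕ} {w : M.obj n}
    (hw : ∀ (m : ℕ) (a : SimplexCategory.mk m ⟶ SimplexCategory.mk n), m < n → M.act a w = 0)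
    (l : Fin (n + 2)) : M.act (δ l) (M.prism w) = if l = 0 then w else 0 := by
  have e : ∀ j : Fin (n + 1), M.act (δ l)
      (∑ i : Fin (n + 2) with j.castSucc < i, M.coord i (M.act (σ j) w)) =
      if l = j.castSucc ∨ l = j.succ then
        ∑ a : Fin (n + 1) with j.castSucc < l.succAbove a, M.coord a w else 0 := by
    intro j
    simp only [map_sum, M.act_coord, act_δ_σ hw]
    rw [Finset.sum_filter, Finset.sum_filter]
    -- The vertices of the simplex are re-indexed by those of the face, so that the double sum
    -- collapses to a sum over `a`.
    have : ∀ i : Fin (n + 2), (if j.castSucc < i then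
        ∑ a with (δ l).toOrderHom a = i,
          M.coord a (if l = j.castSucc ∨ l = j.succ then w else 0) else 0) =
        ∑ a with (δ l).toOrderHom a = i, if j.castSucc < l.succAbove a then
          M.coord a (if l = j.castSucc ∨ l = j.succ then w else 0) else 0 := by
      intro i
      split_ifs with h1 h2 h2
      all_goals first
        | refine Finset.sum_congr rfl fun a ha => ?_
        | refine (Finset.sum_eq_zero fun a ha => ?_).symm
      all_goals
        have ha' : l.succAbove a = i := (Finset.mem_filter.1 ha).2
        simp [ha', h1]
    rw [Finset.sum_congr rfl fun i _ => this i, Finset.sum_fiberwise]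
    split_ifs <;> simp
  simp only [prism, map_sum, map_zsmul, e]
  rcases Fin.eq_zero_or_eq_succ l with rfl | ⟨b, rfl⟩
  · rw [Finset.sum_eq_single 0 (fun j _ hj => ?_) (by simp)]
    · simp [M.sum_coord]
    · rw [if_neg, smul_zero]
      rintro (h | h)
      · exact hj (by rw [Fin.ext_iff] at h ⊢; simpa using h.symm)
      · exact absurd h.symm (Fin.succ_ne_zero j)
  · rw [if_neg (Fin.succ_ne_zero b)]
    have f1 : ∀ a : Fin (n + 1), b.castSucc < b.succ.succAbove a ↔ b < a := by
      intro a
      simp only [Fin.succAbove, Fin.lt_def, Fin.val_succ, Fin.val_castSucc]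
      split_ifs <;> grind
    have f2 : ∀ a : Fin (n + 1), b.succ < b.succ.succAbove a ↔ b < a := by
      intro a
      simp only [Fin.succAbove, Fin.lt_def, Fin.val_succ, Fin.val_castSucc]
      split_ifs <;> grind
    rcases Fin.eq_castSucc_or_eq_last b with ⟨c, rfl⟩ | rfl
    · obtain _ | n := n
      · exact c.elim0
      rw [← Finset.sum_subset (Finset.subset_univ {c.castSucc, c.succ})]
      · rw [Finset.sum_pair (by simp [Fin.ext_iff])]
        simp only [f1, ← Fin.succ_castSucc, f2]
        simp [pow_succ]
      · intro j _ hj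
        simp only [Finset.mem_insert, Finset.mem_singleton, not_or] at hj
        rw [if_neg, smul_zero]
        rintro (h | h)
        · exact hj.2 (by rw [Fin.ext_iff] at h ⊢; simpa using h.symm)
        · exact hj.1 (by rw [Fin.ext_iff] at h ⊢; simpa using h.symm)
    · refine Finset.sum_eq_zero fun j _ => ?_
      split_ifs with h
      · rw [Finset.sum_eq_zero, smul_zero]
        intro a ha
        exfalso
        have ha := (Finset.mem_filter.1 ha).2
        rcases h with h | h
        · rw [← h, f2] at ha
          exact absurd ha (not_lt.2 (Fin.le_last a))
        · obtain rfl := Fin.succ_injective _ h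
          rw [f1] at ha
          exact absurd ha (not_lt.2 (Fin.le_last a))
      · simp

variable {P : ∀ n, AddSubgroup (M.obj n)}

theorem IsStable.prism_mem (hP : M.IsStable P) {n : ℕ} {w : M.obj n} (hw : w ∈ P n) :
    M.prism w ∈ P (n + 1) :=
  sum_mem fun _ _ => zsmul_mem (sum_mem fun _ _ => hP.coord_mem _ (hP.act_mem _ hw)) _

/-- The compatibility condition on elements given on the faces of a simplex. -/
def IsCompatible {n : ℕ} (x : Fin (n + 2) → M.obj n) : Prop :=
  ∀ (m : ℕ) (a b : SimplexCategory.mk m ⟶ SimplexCategory.mk n) (i j : Fin (n + 2)),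
    a ≫ δ i = b ≫ δ j → M.act a (x i) = M.act b (x j)

theorem exists_extension_of_lt (hP : M.IsStable P) {n : ℕ} {x : Fin (n + 2) → M.obj n}
    (hx : IsCompatible x) (hxP : ∀ i, x i ∈ P n) (m : ℕ) (hm : m ≤ n + 1) :
    ∃ z ∈ P (n + 1), ∀ i : Fin (n + 2), n + 1 - m < i → M.act (δ i) z = x i := by
  induction m with
  | zero => exact ⟨0, zero_mem _, fun i hi => by have := i.2; omega⟩
  | succ m ih =>
    obtain ⟨z, hz, h⟩ := ih (by omega)
    -- The next face to repair is `j + 1`. Its defect, made degenerate by `σ j`, is added; on each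
    -- higher face this contributes a degeneracy of a face of the defect, which is zero by
    -- compatibility.
    obtain ⟨j, hj⟩ : ∃ j : Fin (n + 1), (j : ℕ) = n - m := ⟨⟨n - m, by omega⟩, rfl⟩
    refine ⟨z + M.act (σ j) (x j.succ - M.act (δ j.succ) z), add_mem hz
      (hP.act_mem _ (sub_mem (hxP _) (hP.act_mem _ hz))), fun i hi => ?_⟩
    rw [map_add, ← M.act_comp]
    by_cases hij : i = j.succ
    · rw [hij, δ_comp_σ_succ, M.act_id, add_sub_cancel]
    · have hlt : j.succ < i := by
        rw [Fin.ext_iff] at hij; rw [Fin.lt_def]; simp at hij ⊢; omega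
      rw [h i (by rw [Fin.lt_def] at hlt; simp at hlt; omega), add_eq_left]
      obtain _ | n := n
      · exfalso
        have := i.2
        rw [Fin.lt_def] at hlt; simp at hlt; omega
      · have hne : i ≠ 0 := hlt.ne_zero
        obtain ⟨i, rfl⟩ := Fin.exists_succ_eq.2 hne
        have hlt' : j < i := by simpa using hlt
        obtain ⟨j, rfl⟩ := Fin.exists_castSucc_eq.2 (show j ≠ Fin.last _ from
          (hlt'.trans_le (Fin.le_last _)).ne)
        have e : δ i ≫ δ j.castSucc.succ = δ j.succ ≫ δ i.succ := by
          rw [Fin.succ_castSucc, δ_comp_δ]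
          rw [Fin.lt_def] at hlt'; rw [Fin.le_def]; simp at hlt' ⊢; omega
        rw [δ_comp_σ_of_gt hlt', M.act_comp, map_sub, ← M.act_comp, e,
          hx _ _ _ _ _ e, M.act_comp, h _ (by
            rw [Fin.lt_def] at hlt'; simp at hj hlt' ⊢; omega), sub_self, map_zero]

/-- Compatible elements on the faces of a simplex extend to the simplex. -/
theorem exists_extension (hP : M.IsStable P) {n : ℕ} {x : Fin (n + 2) → M.obj n}
    (hx : IsCompatible x) (hxP : ∀ i, x i ∈ P n) :
    ∃ z ∈ P (n + 1), ∀ i : Fin (n + 2), M.act (δ i) z = x i := by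
  -- Every face except face `0` is now correct; the degeneracy `σ 0` would spoil face `1`. The
  -- defect on face `0` vanishes on its own boundary, so the prism operator corrects it without
  -- touching the other faces.
  obtain ⟨z, hz, h⟩ := exists_extension_of_lt hP hx hxP (n + 1) le_rfl
  have hw : ∀ (m : ℕ) (a : SimplexCategory.mk m ⟶ SimplexCategory.mk n), m < n →
      M.act a (x 0 - M.act (δ 0) z) = 0 := by
    intro m a hm
    obtain _ | n := n
    · omega
    obtain ⟨i, b, rfl⟩ := eq_comp_δ_of_not_surjective a (fun hf => by
      rw [← SimplexCategory.epi_iff_surjective] at hf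
      have : n + 1 ≤ m := SimplexCategory.len_le_of_epi a
      omega)
    have e : δ i ≫ δ 0 = δ 0 ≫ δ i.succ := (δ_comp_δ (Fin.zero_le i)).symm
    rw [M.act_comp, map_sub, ← M.act_comp, e, hx _ _ _ _ _ e, M.act_comp, h _ (by simp),
      sub_self, map_zero]
  refine ⟨z + M.prism (x 0 - M.act (δ 0) z), add_mem hz
    (hP.prism_mem (sub_mem (hxP _) (hP.act_mem _ hz))), fun i => ?_⟩
  rw [map_add, act_δ_prism hw]
  split_ifs with hi
  · rw [hi, add_sub_cancel]
  · rw [add_zero, h]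
    have : (i : ℕ) ≠ 0 := fun h => hi (Fin.ext h)
    omega

end CoordModule

/-! ### Maps with the right lifting property with respect to monomorphisms -/

namespace SSet

open MonoidalCategory Simplicial HomotopicalAlgebra modelCategoryQuillen

/-- The disjoint union of two copies of a simplicial set. -/
def double (X : SSet.{u}) : SSet.{u} where
  obj n := X.obj n ⊕ X.obj n
  map θ := ↾(Sum.map (X.map θ) (X.map θ))
  map_id n := by
    refine ConcreteCategory.hom_ext _ _ ?_
    rintro (x | x) <;> simp
  map_comp θ η := by
    refine ConcreteCategory.hom_ext _ _ ?_
    rintro (x | x) <;> simp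

/-- The map out of two copies of `X` given by a pair of maps. -/
def double.desc {X Y : SSet.{u}} (f g : X ⟶ Y) : X.double ⟶ Y where
  app n := ↾(Sum.elim (f.app n) (g.app n))
  naturality _ _ θ := by
    refine ConcreteCategory.hom_ext _ _ ?_
    rintro (x | x)
    · exact NatTrans.naturality_apply f θ x
    · exact NatTrans.naturality_apply g θ x

theorem double.desc_comp {X Y Z : SSet.{u}} (f g : X ⟶ Y) (p : Y ⟶ Z) :
    double.desc f g ≫ p = double.desc (f ≫ p) (g ≫ p) := by
  ext n x
  rcases x with x | x <;> rfl

theorem double.desc_injective {X Y : SSet.{u}} {f g f' g' : X ⟶ Y}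
    (h : double.desc f g = double.desc f' g') : f = f' ∧ g = g' := by
  have h' : ∀ n (x : X.double.obj n), (double.desc f g).app n x = (double.desc f' g').app n x :=
    fun n x => by rw [h]
  constructor
  · ext n x
    exact h' n (Sum.inl x)
  · ext n x
    exact h' n (Sum.inr x : X.obj n ⊕ X.obj n)

/-- The two ends of the cylinder are disjoint because their `Δ[1]`-coordinates are the constants `0`
and `1`. -/
instance (X : SSet.{u}) : Mono (double.desc (ι₀ : X ⟶ X ⊗ Δ[1]) ι₁) := by
  have : ∀ n, Mono ((double.desc (ι₀ : X ⟶ X ⊗ Δ[1]) ι₁).app n) := by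
    intro n
    rw [CategoryTheory.mono_iff_injective]
    have h01 : ∀ x y : X.obj n, (ι₀ : X ⟶ X ⊗ Δ[1]).app n x ≠ (ι₁ : X ⟶ X ⊗ Δ[1]).app n y := by
      intro x y h
      have h0 : (stdSimplex.asOrderHom ((ι₀ : X ⟶ X ⊗ Δ[1]).app n x).2) 0 = 0 := rfl
      have h1 : (stdSimplex.asOrderHom ((ι₁ : X ⟶ X ⊗ Δ[1]).app n y).2) 0 = 1 := rfl
      rw [h, h1] at h0
      exact one_ne_zero h0
    rintro (x | x) (y | y) h
    · exact congrArg Sum.inl (congrArg Prod.fst h)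
    · exact absurd h (h01 x y)
    · exact absurd h.symm (h01 y x)
    · exact congrArg Sum.inr (congrArg Prod.fst h)
  exact NatTrans.mono_of_mono_app _

/-- A homotopy, given by a map out of the cylinder. -/
def Homotopy.ofCylinder {X Y : SSet.{u}} {f g : X ⟶ Y} (H : X ⊗ Δ[1] ⟶ Y)
    (h₀ : ι₀ ≫ H = f) (h₁ : ι₁ ≫ H = g) : Homotopy f g where
  h := H
  h₀ := h₀
  h₁ := h₁
  rel := by
    ext n ⟨x, y⟩
    exact x.2.elim

/-- Postcomposition of a homotopy with a map. -/
def Homotopy.compRight {X Y Z : SSet.{u}} {f g : X ⟶ Y} (H : Homotopy f g) (p : Y ⟶ Z) :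
    Homotopy (f ≫ p) (g ≫ p) :=
  .ofCylinder (H.h ≫ p) (by rw [← Category.assoc, H.h₀]) (by rw [← Category.assoc, H.h₁])

/-- A map with the right lifting property with respect to monomorphisms is an acyclic
fibration. -/
theorem isAcyclicFibration_of_rlp {X Y : SSet.{u}} {p : X ⟶ Y}
    (hp : (MorphismProperty.monomorphisms SSet.{u}).rlp p) : IsAcyclicFibration p := by
  have lift : ∀ {A B : SSet.{u}} (i : A ⟶ B) [Mono i], HasLiftingProperty i p :=
    fun i hi => hp i hi
  refine ⟨?_, fun Z _ => ?_⟩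
  · rw [modelCategoryQuillen.fibration_iff]
    exact MorphismProperty.antitone_rlp J_le_monomorphisms _ hp
  -- Lifting the identity of `Y` against `∅ → Y` produces a section of `p`.
  · have sq : CommSq (Subcomplex.isInitialBot.to X) (⊥ : Y.Subcomplex).ι p (𝟙 Y) :=
      ⟨Subcomplex.isInitialBot.hom_ext _ _⟩
    have := lift (⊥ : Y.Subcomplex).ι
    have hs : sq.lift ≫ p = 𝟙 Y := sq.fac_right
    -- Lifting against the two ends of the cylinder produces a homotopy over `Y` from `p ≫ sq.lift`
    -- to the identity.
    have sq' : CommSq (double.desc (p ≫ sq.lift) (𝟙 X)) (double.desc (ι₀ : X ⟶ X ⊗ Δ[1]) ι₁) p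
        (SemiCartesianMonoidalCategory.fst X Δ[1] ≫ p) := ⟨by
      rw [double.desc_comp, double.desc_comp, Category.assoc, hs]
      rfl⟩
    have := lift (double.desc (ι₀ : X ⟶ X ⊗ Δ[1]) ι₁)
    have hH := sq'.fac_left
    rw [double.desc_comp] at hH
    obtain ⟨h₀, h₁⟩ := double.desc_injective hH
    let H : Homotopy (p ≫ sq.lift) (𝟙 X) := .ofCylinder sq'.lift h₀ h₁
    constructor
    · refine Function.LeftInverse.injective (g := HomotopyClasses.precomp sq.lift Z) ?_
      rintro ⟨φ⟩
      refine congrArg (Quot.mk _) (?_ : sq.lift ≫ p ≫ φ = φ)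
      rw [← Category.assoc, hs, Category.id_comp]
    · rintro ⟨ψ⟩
      refine ⟨Quot.mk _ (sq.lift ≫ ψ), Quot.sound ⟨?_⟩⟩
      have K := H.compRight ψ
      rwa [Category.assoc, Category.id_comp] at K

/-- Lifting against all monomorphisms can be tested on simplices with prescribed boundary. -/
theorem rlp_monomorphisms_of_exists_lift {X Y : SSet.{u}} {p : X ⟶ Y}
    (h0 : ∀ y : Y _⦋0⦌, ∃ x : X _⦋0⦌, p.app _ x = y)
    (h : ∀ (n : ℕ) (x : Fin (n + 2) → X _⦋n⦌) (y : Y _⦋n + 1⦌),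
      (∀ (m : ℕ) (a b : ⦋m⦌ ⟶ ⦋n⦌) (i j : Fin (n + 2)),
        a ≫ SimplexCategory.δ i = b ≫ SimplexCategory.δ j →
          X.map a.op (x i) = X.map b.op (x j)) →
      (∀ i, p.app _ (x i) = Y.δ i y) →
      ∃ z : X _⦋n + 1⦌, (∀ i, X.δ i z = x i) ∧ p.app _ z = y) :
    (MorphismProperty.monomorphisms SSet.{u}).rlp p := by
  suffices key : ∀ n, HasLiftingProperty (boundary.{u} n).ι p by
    -- Every monomorphism is built by attaching simplices along their boundaries.
    rw [rlp_monomorphisms]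
    rintro _ _ _ ⟨n⟩
    exact key n
  intro n
  refine ⟨fun {s t} sq => ?_⟩
  obtain _ | n := n
  -- A vertex has empty boundary, so the only condition is on the image.
  · obtain ⟨x, hx⟩ := h0 (yonedaEquiv t)
    refine ⟨⟨yonedaEquiv.symm x, boundary.hom_ext₀, ?_⟩⟩
    apply yonedaEquiv.injective
    rw [yonedaEquiv_comp, Equiv.apply_symm_apply, hx]
  · have hc : ∀ (m : ℕ) (a b : ⦋m⦌ ⟶ ⦋n⦌) (i j : Fin (n + 2)),
        a ≫ SimplexCategory.δ i = b ≫ SimplexCategory.δ j →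
          X.map a.op (yonedaEquiv (boundary.ι i ≫ s)) =
            X.map b.op (yonedaEquiv (boundary.ι j ≫ s)) := by
      intro m a b i j hab
      have e : stdSimplex.{u}.map a ≫ boundary.ι i = stdSimplex.{u}.map b ≫ boundary.ι j := by
        rw [← cancel_mono (boundary (n + 1)).ι, Category.assoc, Category.assoc, boundary.ι_ι,
          boundary.ι_ι]
        exact (stdSimplex.map_comp a (SimplexCategory.δ i)).symm.trans
          ((congrArg stdSimplex.{u}.map hab).trans (stdSimplex.map_comp b (SimplexCategory.δ j)))
      rw [yonedaEquiv_naturality, yonedaEquiv_naturality, ← Category.assoc, e, Category.assoc]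
    have hb : ∀ i, p.app _ (yonedaEquiv (boundary.ι i ≫ s)) = Y.δ i (yonedaEquiv t) := by
      intro i
      rw [← yonedaEquiv_comp, Category.assoc, sq.w, boundary.ι_ι_assoc,
        stdSimplex.yonedaEquiv_δ_comp]
    obtain ⟨z, hz, hzp⟩ := h n (fun i => yonedaEquiv (boundary.ι i ≫ s)) (yonedaEquiv t) hc hb
    refine ⟨⟨yonedaEquiv.symm z, boundary.hom_ext fun i => ?_, ?_⟩⟩
    · rw [boundary.ι_ι_assoc, stdSimplex.δ_comp_yonedaEquiv_symm, hz, Equiv.symm_apply_apply]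
    · apply yonedaEquiv.injective
      rw [yonedaEquiv_comp, Equiv.apply_symm_apply, hzp]

end SSet

/-! ### Extension of polynomial forms from the boundary of a simplex -/

namespace PolyForms

open SimplexCategory

variable (k : Type u) [Field k]

/-- The pullback of forms along a simplicial operator. -/
def simplicialPullback {p q : ℕ} (a : SimplexCategory.mk p ⟶ SimplexCategory.mk q) :
    PolyForms k (Fin (q + 1)) →ₐ[k] PolyForms k (Fin (p + 1)) :=
  pullback k a.toOrderHom

theorem simplicialPullback_id {n : ℕ} :
    simplicialPullback k (𝟙 (SimplexCategory.mk n)) = AlgHom.id k _ :=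
  pullback_id

theorem simplicialPullback_comp {p q r : ℕ} (a : SimplexCategory.mk p ⟶ SimplexCategory.mk q)
    (b : SimplexCategory.mk q ⟶ SimplexCategory.mk r) :
    simplicialPullback k (a ≫ b) = (simplicialPullback k a).comp (simplicialPullback k b) :=
  pullback_comp (k := k) b.toOrderHom a.toOrderHom

theorem simplicialPullback_t {p q : ℕ} (a : SimplexCategory.mk p ⟶ SimplexCategory.mk q)
    (i : Fin (q + 1)) :
    simplicialPullback k a (t k i) = ∑ j with a.toOrderHom j = i, t k j :=
  pullback_t _ i

theorem simplicialPullback_mem {p q n : ℕ} (a : SimplexCategory.mk p ⟶ SimplexCategory.mk q)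
    {ω : PolyForms k (Fin (q + 1))} (hω : ω ∈ deg k _ n) :
    simplicialPullback k a ω ∈ deg k _ n :=
  pullback_mem _ hω

theorem t_mul_mem {ι : Type} [Fintype ι] (i : ι) {n : ℕ} {ω : PolyForms k ι}
    (hω : ω ∈ deg k ι n) : t k i * ω ∈ deg k ι n := by
  simpa using SetLike.mul_mem_graded (t_mem_deg k i) hω

variable (V : Type v) [AddCommGroup V] [Module k V]

variable {k} in
theorem rTensor_sum {U : Type*} [AddCommGroup U] [Module k U] {W : Type*} [AddCommGroup W]
    [Module k W] {ι : Type*} (s : Finset ι) (φ : ι → U →ₗ[k] W) :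
    LinearMap.rTensor V (∑ i ∈ s, φ i) = ∑ i ∈ s, LinearMap.rTensor V (φ i) :=
  map_sum (LinearMap.rTensorHom V) φ s

/-- The forms on simplices with coefficients in a vector space. -/
def tensorModule : CoordModule.{max u v} where
  obj n := PolyForms k (Fin (n + 1)) ⊗[k] V
  act a := (LinearMap.rTensor V (simplicialPullback k a).toLinearMap).toAddMonoidHom
  act_id x := by
    rw [simplicialPullback_id]
    exact LinearMap.congr_fun (LinearMap.rTensor_id V _) x
  act_comp a b x := by
    rw [simplicialPullback_comp]
    exact LinearMap.rTensor_comp_apply V (simplicialPullback k a).toLinearMap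
      (simplicialPullback k b).toLinearMap x
  coord i := (LinearMap.rTensor V (LinearMap.mulLeft k (t k i))).toAddMonoidHom
  act_coord a i x := by
    show LinearMap.rTensor V _ (LinearMap.rTensor V _ x) =
      ∑ j with a.toOrderHom j = i, LinearMap.rTensor V _ (LinearMap.rTensor V _ x)
    simp only [← LinearMap.rTensor_comp_apply]
    rw [← LinearMap.sum_apply, ← rTensor_sum]
    congr 2
    refine LinearMap.ext fun ω => ?_
    simp [simplicialPullback_t, Finset.sum_mul]
  sum_coord x := by
    show ∑ i, LinearMap.rTensor V (LinearMap.mulLeft k (t k i)) x = x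
    rw [← LinearMap.sum_apply, ← rTensor_sum]
    refine (LinearMap.congr_fun (congrArg (LinearMap.rTensor V) ?_) x).trans
      (LinearMap.congr_fun (LinearMap.rTensor_id V _) x)
    refine LinearMap.ext fun ω => ?_
    simp [← Finset.sum_mul, sum_t]

/-- The linear maps from a vector space to the forms on simplices. -/
def homModule : CoordModule.{max u v} where
  obj n := V →ₗ[k] PolyForms k (Fin (n + 1))
  act a := (LinearMap.compRight k (M := V) (simplicialPullback k a).toLinearMap).toAddMonoidHom
  act_id φ := LinearMap.ext fun x => by
    show simplicialPullback k (𝟙 _) (φ x) = φ x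
    rw [simplicialPullback_id]
    rfl
  act_comp a b φ := LinearMap.ext fun x => by
    show simplicialPullback k (a ≫ b) (φ x) = _
    rw [simplicialPullback_comp]
    rfl
  coord i := (LinearMap.compRight k (M := V) (LinearMap.mulLeft k (t k i))).toAddMonoidHom
  act_coord a i φ := LinearMap.ext fun x => by
    rw [LinearMap.sum_apply]
    show simplicialPullback k a (t k i * φ x) =
      ∑ j with a.toOrderHom j = i, t k j * simplicialPullback k a (φ x)
    rw [map_mul, simplicialPullback_t, Finset.sum_mul]
  sum_coord φ := LinearMap.ext fun x => by
    rw [LinearMap.sum_apply]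
    show ∑ i, t k i * φ x = φ x
    rw [← Finset.sum_mul, sum_t, one_mul]

/-- The forms on a simplex which vanish on its boundary. -/
def boundaryIdeal (n : ℕ) : Submodule k (PolyForms k (Fin (n + 1))) where
  carrier := {ω | ∀ (m : ℕ) (a : SimplexCategory.mk m ⟶ SimplexCategory.mk n), m < n →
    simplicialPullback k a ω = 0}
  zero_mem' _ _ _ := map_zero _
  add_mem' h h' m a hm := by rw [map_add, h m a hm, h' m a hm, add_zero]
  smul_mem' c _ h m a hm := by rw [map_smul, h m a hm, smul_zero]

/-- An operator from a simplex of smaller dimension is not surjective on vertices, so it factors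
through a face. -/
theorem eq_zero_of_act_δ {M : CoordModule.{v}} {n : ℕ} {x : M.obj (n + 1)}
    (h : ∀ i : Fin (n + 2), M.act (δ i) x = 0) (m : ℕ)
    (a : SimplexCategory.mk m ⟶ SimplexCategory.mk (n + 1)) (hm : m < n + 1) : M.act a x = 0 := by
  obtain ⟨i, b, rfl⟩ := eq_comp_δ_of_not_surjective a (fun hf => by
    rw [← SimplexCategory.epi_iff_surjective] at hf
    have : n + 1 ≤ m := SimplexCategory.len_le_of_epi a
    omega)
  rw [M.act_comp, h, map_zero]

/-- A projection onto the forms which vanish on the boundary. -/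
theorem exists_boundaryIdeal_projection (n : ℕ) :
    ∃ π : PolyForms k (Fin (n + 1)) →ₗ[k] PolyForms k (Fin (n + 1)),
      (∀ ω, π ω ∈ boundaryIdeal k n) ∧ (∀ p, ∀ ω ∈ deg k _ p, π ω ∈ deg k _ p) ∧
      ∀ z : PolyForms k (Fin (n + 1)) ⊗[k] V,
        (∀ (m : ℕ) (a : SimplexCategory.mk m ⟶ SimplexCategory.mk n), m < n →
          LinearMap.rTensor V (simplicialPullback k a).toLinearMap z = 0) →
        LinearMap.rTensor V π z = z := by
  obtain _ | n := n
  · exact ⟨LinearMap.id, fun ω m a hm => by omega, fun _ _ h => h,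
      fun z _ => LinearMap.congr_fun (LinearMap.rTensor_id V _) z⟩
  -- The condition is imposed after tensoring with `V`. This avoids having to identify the kernel of
  -- restriction on `Ω ⊗ V` with the boundary ideal tensored with `V`.
  let Q : ∀ m, AddSubgroup (PolyForms k (Fin (n + 1 + 1)) →ₗ[k] PolyForms k (Fin (m + 1))) :=
    fun m =>
    { carrier := {φ | (∀ p, ∀ ω ∈ deg k _ p, φ ω ∈ deg k _ p) ∧
        ∀ z : PolyForms k (Fin (n + 1 + 1)) ⊗[k] V,
          (∀ (m : ℕ) (a : SimplexCategory.mk m ⟶ SimplexCategory.mk (n + 1)), m < n + 1 →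
            LinearMap.rTensor V (simplicialPullback k a).toLinearMap z = 0) →
          LinearMap.rTensor V φ z = 0}
      zero_mem' := ⟨fun _ _ _ => zero_mem _, fun z _ => by
        rw [LinearMap.rTensor_zero, LinearMap.zero_apply]⟩
      add_mem' := fun h h' => ⟨fun p ω hω => add_mem (h.1 p ω hω) (h'.1 p ω hω), fun z hz => by
        rw [LinearMap.rTensor_add, LinearMap.add_apply, h.2 z hz, h'.2 z hz, add_zero]⟩
      neg_mem' := fun h => ⟨fun p ω hω => neg_mem (h.1 p ω hω), fun z hz => by
        rw [LinearMap.rTensor_neg, LinearMap.neg_apply, h.2 z hz, neg_zero]⟩ }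
  let P : ∀ m, AddSubgroup ((homModule k (PolyForms k (Fin (n + 1 + 1)))).obj m) := Q
  have hP : (homModule k (PolyForms k (Fin (n + 1 + 1)))).IsStable P := by
    constructor
    · intro p q a φ hφ
      refine ⟨fun p ω hω => simplicialPullback_mem k a (hφ.1 p ω hω), fun z hz => ?_⟩
      refine (LinearMap.rTensor_comp_apply V (simplicialPullback k a).toLinearMap φ z).trans ?_
      rw [hφ.2 z hz, map_zero]
    · intro m i φ hφ
      refine ⟨fun p ω hω => t_mul_mem k i (hφ.1 p ω hω), fun z hz => ?_⟩
      refine (LinearMap.rTensor_comp_apply V (LinearMap.mulLeft k (t k i)) φ z).trans ?_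
      rw [hφ.2 z hz, map_zero]
  -- The extension result is applied to the restriction maps themselves, a compatible family of
  -- linear maps out of `Ω_{n+1}`. The resulting `φ` is a linear extension operator: `φ ω` has the
  -- boundary values of `ω` and depends only on them. Hence `id - φ` is the projection sought.
  obtain ⟨φ, hφ, h⟩ := CoordModule.exists_extension hP
    (x := fun i => (simplicialPullback k (δ i)).toLinearMap)
    (fun m a b i j e => by
      have := congrArg (fun c => (simplicialPullback k c).toLinearMap) e
      rw [simplicialPullback_comp, simplicialPullback_comp] at this
      exact this)
    (fun i => ⟨fun p ω hω => simplicialPullback_mem k _ hω, fun z hz => hz n (δ i) (by omega)⟩)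
  let ψ : PolyForms k (Fin (n + 1 + 1)) →ₗ[k] PolyForms k (Fin (n + 1 + 1)) := φ
  have hψ : ψ ∈ Q (n + 1) := hφ
  have hδ : ∀ i : Fin (n + 2), (homModule k (PolyForms k (Fin (n + 1 + 1)))).act (δ i)
      (LinearMap.id - ψ : PolyForms k (Fin (n + 1 + 1)) →ₗ[k] PolyForms k (Fin (n + 1 + 1))) =
        0 := by
    intro i
    refine (map_sub ((homModule k (PolyForms k (Fin (n + 1 + 1)))).act (δ i)) _ _).trans ?_
    rw [h]
    exact sub_self _
  refine ⟨LinearMap.id - ψ, fun ω m a hm => ?_, fun p ω hω => sub_mem hω (hψ.1 p ω hω),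
    fun z hz => ?_⟩
  · exact LinearMap.congr_fun (eq_zero_of_act_δ hδ m a hm) ω
  · rw [LinearMap.rTensor_sub, LinearMap.sub_apply, LinearMap.rTensor_id, hψ.2 z hz, sub_zero]
    rfl

end PolyForms

namespace DGLieAlgebra

variable {k : Type u} [Field k]

/-! ### Deforming elements of degree one to Maurer--Cartan elements -/

/-- The curvature `dx + (1/2) [x, x]`. -/
def curvature (g : DGLieAlgebra.{u, v} k) (x : g.carrier) : g.carrier :=
  g.d x + (1 / 2 : k) • g.bracket x x

theorem curvature_mem {g : DGLieAlgebra.{u, v} k} {x : g.carrier} (hx : x ∈ g.deg 1) :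
    g.curvature x ∈ g.deg 2 :=
  add_mem (g.d_mem hx) (Submodule.smul_mem _ _ (g.bracket_mem hx hx))

theorem Hom.map_curvature {g : DGLieAlgebra.{u, v} k} {h : DGLieAlgebra.{u, w} k} (f : g.Hom h)
    (x : g.carrier) : f.toLinearMap (g.curvature x) = h.curvature (f.toLinearMap x) := by
  rw [curvature, curvature, map_add, map_smul, f.map_d, f.map_bracket]

/-- For `x` of degree one, antisymmetry gives `[[x,x],x] = -[x,[x,x]]`, and the Jacobi identity
becomes `3[x,[x,x]] = 0`. -/
theorem bracket_bracket_self [CharZero k] {g : DGLieAlgebra.{u, v} k} {x : g.carrier}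
    (hx : x ∈ g.deg 1) : g.bracket x (g.bracket x x) = 0 := by
  have h1 := g.jacobi x hx hx
  have h2 := g.antisymm (g.bracket_mem hx hx) hx
  norm_num at h1 h2
  rw [h2] at h1
  have h3 : (3 : k) • g.bracket x (g.bracket x x) = 0 := by
    rw [← sub_eq_zero] at h1
    rw [← h1]
    module
  exact (smul_eq_zero.1 h3).resolve_left (by norm_num)

/-- The Bianchi identity. -/
theorem d_curvature [CharZero k] {g : DGLieAlgebra.{u, v} k} {x : g.carrier}
    (hx : x ∈ g.deg 1) : g.d (g.curvature x) = -g.bracket x (g.curvature x) := by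
  have h := g.antisymm (g.d_mem hx) hx
  norm_num at h
  rw [curvature, map_add, map_smul, g.d_d, g.leibniz x hx, h, map_add, map_smul,
    bracket_bracket_self hx]
  module

/-- The bracket is symmetric on elements of degree one, so the two mixed terms agree and absorb the
factor `1/2`. -/
theorem curvature_sub [CharZero k] {g : DGLieAlgebra.{u, v} k} {x z : g.carrier}
    (hx : x ∈ g.deg 1) (hz : z ∈ g.deg 1) : g.curvature (x - z) =
      g.curvature x - g.d z - g.bracket x z + (1 / 2 : k) • g.bracket z z := by
  have h := g.antisymm hz hx
  norm_num at h
  simp only [curvature, map_sub, LinearMap.sub_apply, h]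
  module

/-- A filtration by acyclic homogeneous dg ideals whose terms are lowered by the bracket. -/
structure AcyclicFiltration (g : DGLieAlgebra.{u, v} k) where
  sub : ℕ → ℕ → Submodule k g.carrier
  le_deg : ∀ i n, sub i n ≤ g.deg n
  le : ∀ i n, sub (i + 1) n ≤ sub i n
  bracket_mem : ∀ {i m n : ℕ} {x y : g.carrier}, x ∈ g.deg m → y ∈ sub i n →
    g.bracket x y ∈ sub (i + 1) (m + n)
  exact : ∀ {i n : ℕ} {y : g.carrier}, y ∈ sub i (n + 1) → g.d y = 0 → ∃ z ∈ sub i n, g.d z = y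

/-- An element of degree one whose curvature lies in a nilpotent acyclic filtration is congruent
to a Maurer--Cartan element. -/
theorem AcyclicFiltration.exists_MC [CharZero k] {g : DGLieAlgebra.{u, v} k}
    (L : g.AcyclicFiltration) {N : ℕ} (hN : L.sub N 2 = ⊥) {x : g.carrier} (hx : x ∈ g.deg 1)
    (hR : g.curvature x ∈ L.sub 0 2) : ∃ z ∈ L.sub 0 1, x - z ∈ g.MC := by
  have hle : ∀ i n, L.sub i n ≤ L.sub 0 n := fun i n => by
    induction i with
    | zero => exact le_rfl
    | succ i ih => exact (L.le i n).trans ih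
  have key : ∀ i, ∃ z ∈ L.sub 0 1, g.curvature (x - z) ∈ L.sub i 2 := by
    intro i
    induction i with
    | zero => exact ⟨0, zero_mem _, by rwa [sub_zero]⟩
    | succ i ih =>
      obtain ⟨z, hz, h⟩ := ih
      have hy : x - z ∈ g.deg 1 := sub_mem hx (L.le_deg _ _ hz)
      -- By the Bianchi identity the curvature is closed modulo the next term of the filtration.
      have hd : g.d (g.curvature (x - z)) ∈ L.sub (i + 1) 3 := by
        rw [d_curvature hy]
        exact neg_mem (L.bracket_mem hy h)
      -- Acyclicity of the next term provides `s` there with the same differential as the curvature;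
      -- acyclicity of the current term then provides `t` with `dt` equal to the curvature minus
      -- `s`. Subtracting `t` from `y = x - z` leaves the curvature `s - [y,t] + ½[t,t]`.
      obtain ⟨s, hs, hsd⟩ := L.exact (n := 2) hd (g.d_d _)
      obtain ⟨t, ht, htd⟩ := L.exact (n := 1) (sub_mem h (L.le i 2 hs))
        (by rw [map_sub, hsd, sub_self])
      refine ⟨z + t, add_mem hz (hle _ _ ht), ?_⟩
      rw [← sub_sub, curvature_sub hy (L.le_deg _ _ ht), htd, sub_sub_cancel]
      exact add_mem (sub_mem hs (L.bracket_mem hy ht))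
        (Submodule.smul_mem _ _ (L.bracket_mem (L.le_deg _ _ ht) ht))
  obtain ⟨z, hz, h⟩ := key N
  rw [hN, Submodule.mem_bot] at h
  exact ⟨z, hz, sub_mem hx (L.le_deg _ _ hz), h⟩

/-! ### Acyclic filtrations of `A ⊗ g` -/

/-- A decreasing filtration of a dg Lie algebra with a contraction of its terms. -/
structure Contraction (g : DGLieAlgebra.{u, v} k) where
  sub : ℕ → Submodule k g.carrier
  le : ∀ i, sub (i + 1) ≤ sub i
  bracket_mem : ∀ {i : ℕ} (x : g.carrier) {y : g.carrier}, y ∈ sub i → g.bracket x y ∈ sub (i + 1)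
  -- One homotopy for each term of the filtration; no compatibility between different indices is
  -- needed.
  s : ℕ → g.carrier →ₗ[k] g.carrier
  s_zero : ∀ {i : ℕ} {x : g.carrier}, x ∈ sub i → x ∈ g.deg 0 → s i x = 0
  s_mem : ∀ {i n : ℕ} {x : g.carrier}, x ∈ sub i → x ∈ g.deg (n + 1) → s i x ∈ sub i ⊓ g.deg n
  d_s : ∀ {i n : ℕ} {x : g.carrier}, x ∈ sub i → x ∈ g.deg n →
    g.d (s i x) + s i (g.d x) = x

open GradedKoszul

/-- The degree `n` part of `B ⊗ J`, for subspaces `B` of `A` and `J` of `g`. -/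
def tensorSub (A : CommDGAlgebra.{u, v} k) (g : DGLieAlgebra.{u, w} k) (B : Submodule k A.carrier)
    (J : Submodule k g.carrier) (n : ℕ) : Submodule k (A.carrier ⊗[k] g.carrier) :=
  tensorDeg (fun p => B ⊓ A.deg p) (fun q => J ⊓ g.deg q) n

section

variable {A : CommDGAlgebra.{u, v} k} {g : DGLieAlgebra.{u, w} k} {B : Submodule k A.carrier}

theorem tensorSub_mono {J J' : Submodule k g.carrier} (h : J ≤ J') (n : ℕ) :
    tensorSub A g B J n ≤ tensorSub A g B J' n := by
  refine Submodule.span_le.2 ?_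
  rintro _ ⟨i, j, rfl, a, ha, x, hx, rfl⟩
  exact tmul_mem_tensorDeg (fun p => B ⊓ A.deg p) (fun q => J' ⊓ g.deg q) rfl ha ⟨h hx.1, hx.2⟩

theorem tensorSub_le (J : Submodule k g.carrier) (n : ℕ) :
    tensorSub A g B J n ≤ tensorDeg A.deg g.deg n := by
  refine Submodule.span_le.2 ?_
  rintro _ ⟨i, j, rfl, a, ha, x, hx, rfl⟩
  exact tmul_mem_tensorDeg _ _ rfl ha.2 hx.2

theorem tensorSub_bot (n : ℕ) : tensorSub A g B ⊥ n = ⊥ := by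
  refine Submodule.span_eq_bot.2 ?_
  rintro _ ⟨i, j, rfl, a, ha, x, hx, rfl⟩
  rw [(Submodule.mem_bot k).1 hx.1, TensorProduct.tmul_zero]

theorem tensorBracket_mem_tensorSub (hB : ∀ a, ∀ b ∈ B, a * b ∈ B) {J J' : Submodule k g.carrier}
    (hJ : ∀ x, ∀ y ∈ J, g.bracket x y ∈ J') {m n : ℕ} {z w : A.carrier ⊗[k] g.carrier}
    (hz : z ∈ tensorDeg A.deg g.deg m) (hw : w ∈ tensorSub A g B J n) :
    tensorBracket A g z w ∈ tensorSub A g B J' (m + n) := by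
  refine Submodule.span_le
    (p := (tensorSub A g B J' (m + n)).comap ((tensorBracket A g).flip w)).2 ?_ hz
  rintro _ ⟨i, j, rfl, a, ha, x, hx, rfl⟩
  refine Submodule.span_le
    (p := (tensorSub A g B J' (i + j + n)).comap (tensorBracket A g (a ⊗ₜ x))).2 ?_ hw
  rintro _ ⟨p, q, rfl, b, hb, y, hy, rfl⟩
  show tensorBracket A g (a ⊗ₜ x) (b ⊗ₜ y) ∈ tensorSub A g B J' _
  rw [tensorBracket_tmul A g a hx hb.2]
  exact Submodule.smul_mem _ _ (tmul_mem_tensorDeg (fun p => B ⊓ A.deg p)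
    (fun q => J' ⊓ g.deg q) (by omega) ⟨hB _ _ hb.1, SetLike.mul_mem_graded ha hb.2⟩
    ⟨hJ _ _ hy.1, g.bracket_mem hx hy.2⟩)

/-- The contraction of `A ⊗ g` induced by a contraction of `g`. -/
def tensorContraction (A : CommDGAlgebra.{u, v} k) (s : g.carrier →ₗ[k] g.carrier) :
    A.carrier ⊗[k] g.carrier →ₗ[k] A.carrier ⊗[k] g.carrier :=
  TensorProduct.map (parity A.deg) s

theorem tensorContraction_tmul (s : g.carrier →ₗ[k] g.carrier) {p : ℕ} {a : A.carrier}
    (ha : a ∈ A.deg p) (x : g.carrier) :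
    tensorContraction A s (a ⊗ₜ x) = (-1 : k) ^ p • (a ⊗ₜ[k] s x) := by
  simp [tensorContraction, parity_of_mem A.deg ha, TensorProduct.smul_tmul']

/-- The Koszul sign in the homotopy makes the terms `da ⊗ s x` cancel, and `a ⊗ (ds + sd)x` remains.
The subspace `B` need not be stable under the differential. -/
theorem Contraction.tensorD_tensorContraction (C : g.Contraction) {i n : ℕ}
    {z : A.carrier ⊗[k] g.carrier} (hz : z ∈ tensorSub A g B (C.sub i) n) :
    tensorD A g (tensorContraction A (C.s i) z) + tensorContraction A (C.s i) (tensorD A g z) =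
      z := by
  refine LinearMap.eqOn_span (f := tensorD A g ∘ₗ tensorContraction A (C.s i) +
    tensorContraction A (C.s i) ∘ₗ tensorD A g) (g := LinearMap.id) ?_ hz
  rintro _ ⟨p, q, rfl, a, ha, x, hx, rfl⟩
  simp only [LinearMap.add_apply, LinearMap.comp_apply, LinearMap.id_apply,
    tensorContraction_tmul _ ha.2, tensorD_tmul A g ha.2, map_smul, map_add,
    tensorContraction_tmul _ (A.d_mem ha.2)]
  have h : (-1 : k) ^ p * (-1 : k) ^ p = 1 := by rw [← mul_pow]; simp
  have e := congrArg (fun y => a ⊗ₜ[k] y) (C.d_s hx.1 hx.2)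
  simp only [TensorProduct.tmul_add] at e
  rw [← e, smul_add, smul_smul, smul_smul, h, pow_succ]
  module

theorem Contraction.tensorContraction_mem (C : g.Contraction) {i n : ℕ}
    {z : A.carrier ⊗[k] g.carrier} (hz : z ∈ tensorSub A g B (C.sub i) (n + 1)) :
    tensorContraction A (C.s i) z ∈ tensorSub A g B (C.sub i) n := by
  refine Submodule.span_le (p := (tensorSub A g B (C.sub i) n).comap
    (tensorContraction A (C.s i))).2 ?_ hz
  rintro _ ⟨p, q, hpq, a, ha, x, hx, rfl⟩
  show tensorContraction A (C.s i) (a ⊗ₜ x) ∈ tensorSub A g B (C.sub i) n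
  rw [tensorContraction_tmul _ ha.2]
  refine Submodule.smul_mem _ _ ?_
  -- Degrees are natural numbers, so an element of degree zero in `g` has no room below it; `s`
  -- vanishes there.
  obtain _ | q := q
  · rw [C.s_zero hx.1 hx.2, TensorProduct.tmul_zero]
    exact zero_mem _
  · exact tmul_mem_tensorDeg (fun p => B ⊓ A.deg p) (fun q => C.sub i ⊓ g.deg q) (by omega) ha
      (C.s_mem hx.1 hx.2)

/-- The acyclic filtration of `A ⊗ g` by the subspaces `B ⊗ J_i`, for an ideal `B` of `A` and a
contractible filtration `J_i` of `g`. -/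
def Contraction.acyclicFiltration (C : g.Contraction) (hB : ∀ a, ∀ b ∈ B, a * b ∈ B) :
    (tensor A g).AcyclicFiltration where
  sub i n := tensorSub A g B (C.sub i) n
  le_deg _ _ := tensorSub_le _ _
  le i _ := tensorSub_mono (C.le i) _
  bracket_mem hx hy := tensorBracket_mem_tensorSub hB (fun x _ hy => C.bracket_mem x hy) hx hy
  exact {i n y} hy hd := by
    refine ⟨_, C.tensorContraction_mem hy, ?_⟩
    have := C.tensorD_tensorContraction hy
    rw [show tensorD A g y = 0 from hd, map_zero, add_zero] at this
    exact this

end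

end DGLieAlgebra

/-! ### Linear algebra of graded vector spaces -/

section LinearAlgebra

variable {k : Type u} [Field k] {V : Type v} [AddCommGroup V] [Module k V]
  {W : Type w} [AddCommGroup W] [Module k W]

/-- A basis of `q` makes the choice of preimages linear. The map is then extended to all of `W`, so
that it can be composed freely with maps of the ambient spaces. -/
theorem Submodule.exists_linear_choice (p : Submodule k V) (q : Submodule k W) (d : V →ₗ[k] W)
    (h : ∀ z ∈ q, ∃ w ∈ p, d w = z) :
    ∃ σ : W →ₗ[k] V, ∀ z ∈ q, σ z ∈ p ∧ d (σ z) = z := by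
  choose! c hc hd using h
  let b := Module.Basis.ofVectorSpace k q
  let r : q →ₗ[k] p := b.constr k (fun i => ⟨c (b i), hc _ (b i).2⟩)
  have hr : d ∘ₗ p.subtype ∘ₗ r = q.subtype := b.ext fun i => by
    simp only [r, LinearMap.comp_apply, b.constr_basis]
    exact hd _ (b i).2
  obtain ⟨σ, hσ⟩ := LinearMap.exists_extend (p.subtype ∘ₗ r)
  refine ⟨σ, fun z hz => ?_⟩
  have e : σ z = r ⟨z, hz⟩ := LinearMap.congr_fun hσ ⟨z, hz⟩
  rw [e]
  exact ⟨(r ⟨z, hz⟩).2, LinearMap.congr_fun hr ⟨z, hz⟩⟩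

namespace GradedKoszul

variable (𝒜 : ℕ → Submodule k V) [DirectSum.Decomposition 𝒜]

/-- The linear map which is given by `F n` on the degree `n` part. -/
def piecewise (F : ℕ → V →ₗ[k] W) : V →ₗ[k] W :=
  DirectSum.toModule k ℕ W (fun n => F n ∘ₗ (𝒜 n).subtype) ∘ₗ
    (DirectSum.decomposeLinearEquiv 𝒜).toLinearMap

variable {𝒜} in
theorem piecewise_of_mem (F : ℕ → V →ₗ[k] W) {n : ℕ} {v : V} (hv : v ∈ 𝒜 n) :
    piecewise 𝒜 F v = F n v := by
  lift v to 𝒜 n using hv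
  simp [piecewise, DirectSum.toModule_lof]

/-- The projection to the degree `n` part. -/
def component (n : ℕ) : V →ₗ[k] V :=
  piecewise 𝒜 (fun m => if m = n then LinearMap.id else 0)

variable {𝒜}

theorem component_self {n : ℕ} {v : V} (hv : v ∈ 𝒜 n) : component 𝒜 n v = v := by
  rw [component, piecewise_of_mem _ hv, if_pos rfl, LinearMap.id_apply]

theorem component_of_ne {m n : ℕ} {v : V} (hv : v ∈ 𝒜 m) (h : m ≠ n) :
    component 𝒜 n v = 0 := by
  rw [component, piecewise_of_mem _ hv, if_neg h, LinearMap.zero_apply]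

theorem component_mem (n : ℕ) (v : V) : component 𝒜 n v ∈ 𝒜 n := by
  induction v using DirectSum.Decomposition.inductionOn 𝒜 with
  | zero => rw [map_zero]; exact zero_mem _
  | add a b ha hb => rw [map_add]; exact add_mem ha hb
  | @homogeneous m a =>
    by_cases h : m = n
    · subst h
      rw [component_self a.2]
      exact a.2
    · rw [component_of_ne a.2 h]
      exact zero_mem _

/-- A map of degree zero commutes with the projections to the homogeneous parts. -/
theorem map_component {ℬ : ℕ → Submodule k W} [DirectSum.Decomposition ℬ] {f : V →ₗ[k] W}
    (hf : ∀ n, ∀ v ∈ 𝒜 n, f v ∈ ℬ n) (n : ℕ) (v : V) :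
    f (component 𝒜 n v) = component ℬ n (f v) := by
  induction v using DirectSum.Decomposition.inductionOn 𝒜 with
  | zero => simp
  | add a b ha hb => simp [ha, hb]
  | @homogeneous m a =>
    by_cases h : m = n
    · subst h
      rw [component_self a.2, component_self (hf _ _ a.2)]
    · rw [component_of_ne a.2 h, component_of_ne (hf _ _ a.2) h, map_zero]

/-- A surjective map of degree zero has a section of degree zero. -/
theorem exists_section {ℬ : ℕ → Submodule k W} [DirectSum.Decomposition ℬ] {f : V →ₗ[k] W}
    (hf : ∀ n, ∀ v ∈ 𝒜 n, f v ∈ ℬ n) (hs : Function.Surjective f) :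
    ∃ σ : W →ₗ[k] V, (∀ n, ∀ w ∈ ℬ n, σ w ∈ 𝒜 n) ∧ ∀ w, f (σ w) = w := by
  obtain ⟨τ, hτ⟩ := f.exists_rightInverse_of_surjective (LinearMap.range_eq_top.2 hs)
  -- An arbitrary linear section becomes graded when only its degree `n` component is kept on the
  -- degree `n` part.
  refine ⟨piecewise ℬ fun n => component 𝒜 n ∘ₗ τ, fun n w hw => ?_, fun w => ?_⟩
  · rw [piecewise_of_mem _ hw]
    exact component_mem _ _
  · induction w using DirectSum.Decomposition.inductionOn ℬ with
    | zero => simp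
    | add a b ha hb => rw [map_add, map_add, ha, hb]
    | @homogeneous n a =>
      rw [piecewise_of_mem _ a.2, LinearMap.comp_apply, map_component hf,
        show f (τ a) = a from LinearMap.congr_fun hτ _, component_self a.2]

end GradedKoszul

end LinearAlgebra

/-! ### Quasi-isomorphisms of complexes of modules -/

namespace ModuleCat

variable {k : Type u} [Field k] {K L : CochainComplex (ModuleCat.{w} k) ℕ} (φ : K ⟶ L)
  [QuasiIso φ] {i j l : ℕ}

/-- This is injectivity on cohomology for elements. The criterion up to refinements is applied to
the universal case, the space `S` of all pairs `(x, v)` satisfying the hypotheses, and then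
evaluated at a preimage of the given pair. -/
theorem exists_d_eq_of_quasiIso (hi : (ComplexShape.up ℕ).prev j = i)
    (hl : (ComplexShape.up ℕ).next j = l) (x : K.X j) (hx : K.d j l x = 0) (v : L.X i)
    (hv : φ.f j x = L.d i j v) : ∃ y : K.X i, K.d i j y = x := by
  have hm : Mono (HomologicalComplex.homologyMap φ j) := inferInstance
  rw [HomologicalComplex.mono_homologyMap_iff_up_to_refinements φ i j l hi hl] at hm
  let S : Submodule k (K.X j × L.X i) :=
    LinearMap.ker ((K.d j l).hom ∘ₗ LinearMap.fst k _ _) ⊓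
      LinearMap.ker ((φ.f j).hom ∘ₗ LinearMap.fst k _ _ - (L.d i j).hom ∘ₗ LinearMap.snd k _ _)
  obtain ⟨A', π, hπ, x₁, h⟩ := hm (A := ModuleCat.of k S)
    (ModuleCat.ofHom (LinearMap.fst k _ _ ∘ₗ S.subtype))
    (ModuleCat.hom_ext (LinearMap.ext fun s => s.2.1))
    (ModuleCat.ofHom (LinearMap.snd k _ _ ∘ₗ S.subtype))
    (ModuleCat.hom_ext (LinearMap.ext fun s => sub_eq_zero.1 s.2.2))
  obtain ⟨a, ha⟩ := (ModuleCat.epi_iff_surjective π).1 hπ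
    ⟨(x, v), hx, sub_eq_zero.2 hv⟩
  refine ⟨x₁ a, ?_⟩
  have := LinearMap.congr_fun (ModuleCat.hom_ext_iff.1 h) a
  refine Eq.trans this.symm ?_
  show (π a).1.1 = x
  rw [ha]

/-- This is surjectivity on cohomology for elements, with the space of all cocycles as the universal
case. -/
theorem exists_cocycle_of_quasiIso (hi : (ComplexShape.up ℕ).prev j = i)
    (hl : (ComplexShape.up ℕ).next j = l) (y : L.X j) (hy : L.d j l y = 0) :
    ∃ x : K.X j, K.d j l x = 0 ∧ ∃ v : L.X i, y = φ.f j x + L.d i j v := by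
  have hm : Epi (HomologicalComplex.homologyMap φ j) := inferInstance
  rw [HomologicalComplex.epi_homologyMap_iff_up_to_refinements φ i j l hi hl] at hm
  obtain ⟨A', π, hπ, x₂, hx₂, y₁, h⟩ := hm
    (A := ModuleCat.of k (LinearMap.ker (L.d j l).hom))
    (ModuleCat.ofHom (LinearMap.ker (L.d j l).hom).subtype)
    (ModuleCat.hom_ext (LinearMap.ext fun s => s.2))
  obtain ⟨a, ha⟩ := (ModuleCat.epi_iff_surjective π).1 hπ ⟨y, hy⟩
  refine ⟨x₂ a, LinearMap.congr_fun (ModuleCat.hom_ext_iff.1 hx₂) a, y₁ a, ?_⟩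
  have := LinearMap.congr_fun (ModuleCat.hom_ext_iff.1 h) a
  refine Eq.trans ?_ this
  show y = (π a).1
  rw [ha]

end ModuleCat

namespace DGLieAlgebra

open GradedKoszul

variable {k : Type u} [Field k]

/-! ### The kernel of an acyclic fibration -/

theorem lcs_le (g : DGLieAlgebra.{u, w} k) (i : ℕ) : g.lcs (i + 1) ≤ g.lcs i := by
  induction i with
  | zero => exact le_top
  | succ i ih =>
    refine Submodule.span_le.2 ?_
    rintro _ ⟨x, y, hy, rfl⟩
    exact g.bracket_mem_lcs x (ih hy)

/-- Bracketing with a homogeneous element only shifts the homogeneous components, so each term of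
the lower central series is a graded subspace. This is what allows homogeneous preimages to be
chosen inside `lcs i`. -/
theorem component_mem_lcs (g : DGLieAlgebra.{u, w} k) {i : ℕ} (n : ℕ) {x : g.carrier}
    (hx : x ∈ g.lcs i) : component g.deg n x ∈ g.lcs i := by
  induction i generalizing x n with
  | zero => exact Submodule.mem_top
  | succ i ih =>
    refine Submodule.span_le (p := (g.lcs (i + 1)).comap (component g.deg n)).2 ?_ hx
    rintro _ ⟨x, y, hy, rfl⟩
    show component g.deg n (g.bracket x y) ∈ g.lcs (i + 1)
    clear hx
    induction x using DirectSum.Decomposition.inductionOn g.deg with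
    | zero => simp
    | add a b ha hb => rw [map_add, LinearMap.add_apply, map_add]; exact add_mem ha hb
    | @homogeneous p x =>
      have key : ∀ y' : g.carrier, component g.deg n (g.bracket x y') =
          if p ≤ n then g.bracket x (component g.deg (n - p) y') else 0 := by
        intro y'
        induction y' using DirectSum.Decomposition.inductionOn g.deg with
        | zero => simp
        | add a b ha hb =>
          rw [map_add, map_add, ha, hb]
          split_ifs <;> simp
        | @homogeneous q y' =>
          have hm := g.bracket_mem x.2 y'.2
          split_ifs with hpn
          · by_cases h : p + q = n
            · subst h
              rw [component_self hm, Nat.add_sub_cancel_left, component_self y'.2]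
            · rw [component_of_ne hm h, component_of_ne y'.2 (by omega), map_zero]
          · rw [component_of_ne hm (by omega)]
      rw [key]
      split_ifs
      · exact g.bracket_mem_lcs _ (ih _ hy)
      · exact zero_mem _

variable {g h : DGLieAlgebra.{u, w} k} {f : g.Hom h}

theorem Hom.exists_mem_lcs (hf : Function.Surjective f.toLinearMap) {i : ℕ} {y : h.carrier}
    (hy : y ∈ h.lcs i) : ∃ x ∈ g.lcs i, f.toLinearMap x = y := by
  induction i generalizing y with
  | zero =>
    obtain ⟨x, hx⟩ := hf y
    exact ⟨x, Submodule.mem_top, hx⟩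
  | succ i ih =>
    refine Submodule.span_le (p := (g.lcs (i + 1)).map f.toLinearMap).2 ?_ hy
    rintro _ ⟨a, b, hb, rfl⟩
    obtain ⟨a, rfl⟩ := hf a
    obtain ⟨c, hc, rfl⟩ := ih hb
    exact ⟨_, g.bracket_mem_lcs a hc, f.map_bracket a c⟩

theorem Hom.exists_mem_lcs_deg (hf : Function.Surjective f.toLinearMap) {i n : ℕ} {y : h.carrier}
    (hy : y ∈ h.lcs i) (hyn : y ∈ h.deg n) :
    ∃ x ∈ g.lcs i, x ∈ g.deg n ∧ f.toLinearMap x = y := by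
  obtain ⟨x, hx, rfl⟩ := Hom.exists_mem_lcs hf hy
  refine ⟨component g.deg n x, g.component_mem_lcs n hx, component_mem n x, ?_⟩
  rw [map_component (ℬ := h.deg) (fun n v hv => f.map_deg hv), component_self hyn]

theorem lcsComplex_d_apply (g : DGLieAlgebra.{u, w} k) (i n : ℕ)
    (x : ↥(g.lcs i ⊓ g.deg n)) :
    ((g.lcsComplex i).d n (n + 1)) x = (⟨g.d x, g.d_mem_lcs x.2.1, g.d_mem x.2.2⟩ :
      ↥(g.lcs i ⊓ g.deg (n + 1))) := by
  rw [lcsComplex_d]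
  rfl

theorem Hom.IsAcyclicFibration.eq_zero (hf : f.IsAcyclicFibration) {i : ℕ} {z : g.carrier}
    (hz : z ∈ g.lcs i) (hz0 : z ∈ g.deg 0) (hd : g.d z = 0) (hfz : f.toLinearMap z = 0) :
    z = 0 := by
  have := hf.quasiIso i
  obtain ⟨y, hy⟩ := ModuleCat.exists_d_eq_of_quasiIso (f.lcsMap i) (i := 0) (j := 0) (l := 1)
    (by simp) (by simp) (⟨z, hz, hz0⟩ : ↥(g.lcs i ⊓ g.deg 0))
    ((lcsComplex_d_apply g i 0 _).trans (Subtype.ext hd)) 0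
    ((Subtype.ext hfz : (⟨f.toLinearMap z, _⟩ : ↥(h.lcs i ⊓ h.deg 0)) = 0).trans
      (map_zero _).symm)
  -- The predecessor of `0` is `0` by convention and the differential from `0` to `0` vanishes, so a
  -- coboundary in degree zero is zero.
  rw [(g.lcsComplex i).shape 0 0 (by simp)] at hy
  exact (congrArg Subtype.val hy).symm

/-- This is the long exact sequence of `ker f ∩ lcs i → g.lcs i → h.lcs i`, in elements. Injectivity
on cohomology gives a primitive `w` of `z`; its image is closed, hence of the form `f x + dv` with
`x` closed by surjectivity on cohomology. Once `v` is lifted to `g`, the element `w - x - dv` is a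
primitive in the kernel. -/
theorem Hom.IsAcyclicFibration.exists_d_eq (hf : f.IsAcyclicFibration) {i n : ℕ} {z : g.carrier}
    (hz : z ∈ g.lcs i) (hzn : z ∈ g.deg (n + 1)) (hd : g.d z = 0) (hfz : f.toLinearMap z = 0) :
    ∃ w ∈ g.lcs i, w ∈ g.deg n ∧ f.toLinearMap w = 0 ∧ g.d w = z := by
  have := hf.quasiIso i
  obtain ⟨⟨w, hw⟩, e⟩ := ModuleCat.exists_d_eq_of_quasiIso (f.lcsMap i) (i := n) (j := n + 1)
    (l := n + 1 + 1) (by simp) (by simp) (⟨z, hz, hzn⟩ : ↥(g.lcs i ⊓ g.deg (n + 1)))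
    ((lcsComplex_d_apply g i _ _).trans (Subtype.ext hd)) 0
    ((Subtype.ext hfz : (⟨f.toLinearMap z, _⟩ : ↥(h.lcs i ⊓ h.deg (n + 1))) = 0).trans
      (map_zero _).symm)
  have hwz : g.d w = z := congrArg Subtype.val ((lcsComplex_d_apply g i n ⟨w, hw⟩).symm.trans e)
  have hfw : h.d (f.toLinearMap w) = 0 := by rw [← f.map_d, hwz, hfz]
  -- Here `p` is `n - 1`, except that it is `0` for `n = 0`; in that case the term `dv` disappears.
  obtain ⟨p, hp⟩ : ∃ p, (ComplexShape.up ℕ).prev n = p := ⟨_, rfl⟩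
  obtain ⟨⟨x, hx⟩, hxd, v, hv⟩ := ModuleCat.exists_cocycle_of_quasiIso (f.lcsMap i) (i := p)
    (j := n) (l := n + 1) hp (by simp)
    (⟨f.toLinearMap w, f.map_mem_lcs hw.1, f.map_deg hw.2⟩ : ↥(h.lcs i ⊓ h.deg n))
    ((lcsComplex_d_apply h i n _).trans (Subtype.ext hfw))
  have hx0 : g.d x = 0 := congrArg Subtype.val ((lcsComplex_d_apply g i n ⟨x, hx⟩).symm.trans hxd)
  obtain _ | n := n
  · obtain rfl : 0 = p := by simpa using hp
    rw [(h.lcsComplex i).shape 0 0 (by simp)] at hv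
    have hv : f.toLinearMap w = f.toLinearMap x + 0 := congrArg Subtype.val hv
    exact ⟨w - x, sub_mem hw.1 hx.1, sub_mem hw.2 hx.2, by rw [map_sub, hv, add_zero, sub_self],
      by rw [map_sub, hwz, hx0, sub_zero]⟩
  · obtain rfl : n = p := by simpa using hp
    obtain ⟨v, hvm⟩ := v
    rw [lcsComplex_d_apply h i n ⟨v, hvm⟩] at hv
    have hv : f.toLinearMap w = f.toLinearMap x + h.d v := congrArg Subtype.val hv
    obtain ⟨v, hv1, hv2, rfl⟩ := Hom.exists_mem_lcs_deg hf.surjective hvm.1 hvm.2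
    refine ⟨w - x - g.d v, sub_mem (sub_mem hw.1 hx.1) (g.d_mem_lcs hv1),
      sub_mem (sub_mem hw.2 hx.2) (g.d_mem hv2), ?_, ?_⟩
    · rw [map_sub, map_sub, hv, f.map_d, add_sub_cancel_left, sub_self]
    · rw [map_sub, map_sub, hwz, hx0, g.d_d, sub_zero, sub_zero]

/-- The kernel of an acyclic fibration, filtered by the lower central series, is contractible. -/
theorem Hom.IsAcyclicFibration.exists_contraction (hf : f.IsAcyclicFibration) :
    ∃ C : g.Contraction, ∀ i, C.sub i = LinearMap.ker f.toLinearMap ⊓ g.lcs i := by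
  let J : ℕ → Submodule k g.carrier := fun i => LinearMap.ker f.toLinearMap ⊓ g.lcs i
  have dJ : ∀ i, ∀ x ∈ J i, g.d x ∈ J i := fun i x hx =>
    ⟨LinearMap.mem_ker.2 (by
      rw [f.map_d, LinearMap.mem_ker.1 hx.1, map_zero]), g.d_mem_lcs hx.2⟩
  have ex : ∀ i n, ∃ σ : g.carrier →ₗ[k] g.carrier,
      ∀ z ∈ J i ⊓ g.deg (n + 1) ⊓ LinearMap.ker g.d, σ z ∈ J i ⊓ g.deg n ∧ g.d (σ z) = z := by
    refine fun i n => Submodule.exists_linear_choice _ _ g.d fun z hz => ?_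
    obtain ⟨w, h1, h2, h3, h4⟩ := hf.exists_d_eq hz.1.1.2 hz.1.2 hz.2 hz.1.1.1
    exact ⟨w, ⟨⟨h3, h1⟩, h2⟩, h4⟩
  choose σ hσ using ex
  -- The map `σ` inverts the differential only on closed elements. Since `x - σ(dx)` is closed, `σ`
  -- may be applied to it, and the result is a homotopy defined on all of `J i`.
  let F : ℕ → ℕ → g.carrier →ₗ[k] g.carrier := fun i n =>
    n.casesOn 0 (fun n => σ i n ∘ₗ (LinearMap.id - σ i (n + 1) ∘ₗ g.d))
  have hσd : ∀ i n, ∀ x ∈ J i, x ∈ g.deg n → σ i n (g.d x) ∈ J i ⊓ g.deg n ∧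
      g.d (σ i n (g.d x)) = g.d x := fun i n x hx hxn =>
    hσ i n _ ⟨⟨dJ i x hx, g.d_mem hxn⟩, g.d_d x⟩
  have hF : ∀ i n, ∀ x ∈ J i, x ∈ g.deg (n + 1) → F i (n + 1) x ∈ J i ⊓ g.deg n ∧
      g.d (F i (n + 1) x) = x - σ i (n + 1) (g.d x) := fun i n x hx hxn =>
    hσ i n _ ⟨(J i ⊓ g.deg (n + 1)).sub_mem ⟨hx, hxn⟩ (hσd i (n + 1) x hx hxn).1,
      LinearMap.mem_ker.2 (by
        rw [LinearMap.sub_apply, map_sub]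
        exact sub_eq_zero.2 (hσd i (n + 1) x hx hxn).2.symm)⟩
  have hFd : ∀ i n, ∀ x ∈ J i, x ∈ g.deg n → F i (n + 1) (g.d x) = σ i n (g.d x) := by
    intro i n x hx hxn
    show σ i n (g.d x - σ i (n + 1) (g.d (g.d x))) = _
    rw [g.d_d, map_zero, sub_zero]
  refine ⟨⟨J, fun i => inf_le_inf le_rfl (g.lcs_le i), fun x y hy => ⟨?_, ?_⟩,
    fun i => piecewise g.deg (F i), fun hx hx0 => ?_, fun hx hxn => ?_, ?_⟩, fun i => rfl⟩
  · refine LinearMap.mem_ker.2 ?_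
    rw [f.map_bracket, LinearMap.mem_ker.1 hy.1, map_zero]
  · exact g.bracket_mem_lcs x hy.2
  · rw [piecewise_of_mem _ hx0]
    rfl
  · rw [piecewise_of_mem _ hxn]
    exact (hF _ _ _ hx hxn).1
  · intro i n x hx hxn
    rw [piecewise_of_mem _ hxn, piecewise_of_mem _ (g.d_mem hxn), hFd i n x hx hxn]
    obtain _ | n := n
    -- In degree zero the homotopy identity says `σ(dx) = x`; the difference is a closed element of
    -- the kernel of degree zero, hence zero.
    · rw [show F i 0 x = 0 from rfl, map_zero, zero_add, ← sub_eq_zero]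
      have hm : σ i 0 (g.d x) - x ∈ J i ⊓ g.deg 0 :=
        sub_mem (hσd i 0 x hx hxn).1 ⟨hx, hxn⟩
      exact hf.eq_zero hm.1.2 hm.2 (by rw [map_sub, (hσd i 0 x hx hxn).2, sub_self]) hm.1.1
    · rw [(hF i n x hx hxn).2, sub_add_cancel]

end DGLieAlgebra

/-! ### Lifting Maurer--Cartan elements along an acyclic fibration -/

/-- The operators `π ⊗ 1` and `1 ⊗ (1 - σf)` fix `z` separately, hence so does their product. This
puts `z` in a tensor product of two subspaces without any argument about intersections. -/
theorem TensorProduct.map_sub_comp_eq_self {k A V W : Type*} [Field k] [AddCommGroup A]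
    [Module k A] [AddCommGroup V] [Module k V] [AddCommGroup W] [Module k W] {π : A →ₗ[k] A}
    {f : V →ₗ[k] W} {σ : W →ₗ[k] V} {z : A ⊗[k] V} (hπ : LinearMap.rTensor V π z = z)
    (hf : LinearMap.lTensor A f z = 0) : TensorProduct.map π (LinearMap.id - σ ∘ₗ f) z = z := by
  rw [← LinearMap.rTensor_comp_lTensor, LinearMap.comp_apply, LinearMap.lTensor_sub,
    LinearMap.lTensor_comp, LinearMap.lTensor_id, LinearMap.sub_apply, LinearMap.comp_apply, hf,
    map_zero, sub_zero, LinearMap.id_apply, hπ]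

namespace DGLieAlgebra

open GradedKoszul PolyForms

variable {k : Type u} [Field k]

/-- The simplicial operators on forms with values in a dg Lie algebra. -/
abbrev formsPullback (g : DGLieAlgebra.{u, v} k) {p q : ℕ}
    (a : SimplexCategory.mk p ⟶ SimplexCategory.mk q) : (g.forms q).Hom (g.forms p) :=
  tensorMap (pullbackHom k a.toOrderHom) (Hom.id g)

/-- The map on forms induced by a morphism of dg Lie algebras. -/
abbrev Hom.formsMap {g h : DGLieAlgebra.{u, v} k} (f : g.Hom h) (n : ℕ) :
    (g.forms n).Hom (h.forms n) :=
  tensorMap (CommDGAlgebra.Hom.id (cdga k (Fin (n + 1)))) f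

theorem formsPullback_comp (g : DGLieAlgebra.{u, v} k) {p q r : ℕ}
    (a : SimplexCategory.mk p ⟶ SimplexCategory.mk q)
    (b : SimplexCategory.mk q ⟶ SimplexCategory.mk r) (x : (g.forms r).carrier) :
    (g.formsPullback (a ≫ b)).toLinearMap x =
      (g.formsPullback a).toLinearMap ((g.formsPullback b).toLinearMap x) :=
  (tensorModule k g.carrier).act_comp a b x

theorem Hom.formsMap_formsPullback {g h : DGLieAlgebra.{u, v} k} (f : g.Hom h) {p q : ℕ}
    (a : SimplexCategory.mk p ⟶ SimplexCategory.mk q) (x : (g.forms q).carrier) :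
    (f.formsMap p).toLinearMap ((g.formsPullback a).toLinearMap x) =
      (h.formsPullback a).toLinearMap ((f.formsMap q).toLinearMap x) := by
  refine LinearMap.congr_fun
    (f := (f.formsMap p).toLinearMap ∘ₗ (g.formsPullback a).toLinearMap)
    (g := (h.formsPullback a).toLinearMap ∘ₗ (f.formsMap q).toLinearMap)
    (TensorProduct.ext' fun ω x => ?_) x
  rfl

variable {g h : DGLieAlgebra.{u, v} k} {f : g.Hom h}

theorem curvature_eq_zero {x : g.carrier} (hx : x ∈ g.MC) : g.curvature x = 0 := hx.2

/-- A section of degree zero of a surjective morphism, with values in forms. -/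
theorem Hom.exists_formsMap_eq (hf : Function.Surjective f.toLinearMap) {n p : ℕ}
    {y : (h.forms n).carrier} (hy : y ∈ (h.forms n).deg p) :
    ∃ x ∈ (g.forms n).deg p, (f.formsMap n).toLinearMap x = y := by
  obtain ⟨σ, hσ, hfσ⟩ := exists_section (𝒜 := g.deg) (ℬ := h.deg) (fun _ _ hv => f.map_deg hv) hf
  refine Submodule.span_le (p := ((g.forms n).deg p).map (f.formsMap n).toLinearMap).2 ?_ hy
  rintro _ ⟨i, j, hij, a, ha, x, hx, rfl⟩
  refine ⟨a ⊗ₜ σ x, tmul_mem_tensorDeg _ _ hij ha (hσ _ _ hx), ?_⟩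
  show a ⊗ₜ[k] f.toLinearMap (σ x) = _
  rw [hfσ]

/-- Forms with values in `g` which vanish on the boundary and are killed by `f` lie in the tensor
product of the forms vanishing on the boundary with the kernel of `f`. -/
theorem Hom.mem_tensorSub (hf : Function.Surjective f.toLinearMap) {n p : ℕ}
    {z : (g.forms n).carrier} (hz : z ∈ (g.forms n).deg p)
    (hfz : (f.formsMap n).toLinearMap z = 0)
    (hb : ∀ (m : ℕ) (a : SimplexCategory.mk m ⟶ SimplexCategory.mk n), m < n →
      (g.formsPullback a).toLinearMap z = 0) :
    z ∈ tensorSub (cdga k (Fin (n + 1))) g (boundaryIdeal k n) (LinearMap.ker f.toLinearMap) p := by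
  obtain ⟨σ, hσ, hfσ⟩ := exists_section (𝒜 := g.deg) (ℬ := h.deg) (fun _ _ hv => f.map_deg hv) hf
  obtain ⟨π, hπ, hπd, hπz⟩ := exists_boundaryIdeal_projection k g.carrier n
  have e1 : LinearMap.rTensor g.carrier π z = z := hπz z hb
  -- As `σ` is a section of `f`, the map `ρ` takes values in `ker f`; it preserves degrees, as does
  -- `π`.
  let ρ : g.carrier →ₗ[k] g.carrier := LinearMap.id - σ ∘ₗ f.toLinearMap
  have e3 : TensorProduct.map π ρ z = z := TensorProduct.map_sub_comp_eq_self e1 hfz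
  rw [← e3]
  refine Submodule.span_le (p := (tensorSub (cdga k (Fin (n + 1))) g (boundaryIdeal k n)
    (LinearMap.ker f.toLinearMap) p).comap (TensorProduct.map π ρ)).2 ?_ hz
  rintro _ ⟨i, j, hij, a, ha, x, hx, rfl⟩
  refine tmul_mem_tensorDeg (fun p => boundaryIdeal k n ⊓ (cdga k (Fin (n + 1))).deg p)
    (fun q => LinearMap.ker f.toLinearMap ⊓ g.deg q) hij ⟨hπ a, hπd _ _ ha⟩
    ⟨?_, sub_mem hx (hσ _ _ (f.map_deg hx))⟩
  refine LinearMap.mem_ker.2 ?_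
  rw [LinearMap.sub_apply, map_sub, LinearMap.comp_apply, hfσ, LinearMap.id_apply, sub_self]

theorem mul_mem_boundaryIdeal {n : ℕ} (a : PolyForms k (Fin (n + 1)))
    {b : PolyForms k (Fin (n + 1))} (hb : b ∈ boundaryIdeal k n) : a * b ∈ boundaryIdeal k n :=
  fun m c hm => by rw [map_mul, hb m c hm, mul_zero]

/-- A form of degree one whose image and whose restriction to the boundary are Maurer--Cartan
elements can be deformed to a Maurer--Cartan element, with the same image and restriction. -/
theorem Hom.IsAcyclicFibration.exists_MC [CharZero k] (hf : f.IsAcyclicFibration)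
    (hg : g.IsNilpotent) {n : ℕ} {x : (g.forms n).carrier} (hx : x ∈ (g.forms n).deg 1)
    (hfx : (f.formsMap n).toLinearMap x ∈ (h.forms n).MC)
    (hb : ∀ (m : ℕ) (a : SimplexCategory.mk m ⟶ SimplexCategory.mk n), m < n →
      (g.formsPullback a).toLinearMap x ∈ (g.forms m).MC) :
    ∃ z ∈ (g.forms n).MC, (f.formsMap n).toLinearMap z = (f.formsMap n).toLinearMap x ∧
      ∀ (m : ℕ) (a : SimplexCategory.mk m ⟶ SimplexCategory.mk n), m < n →
        (g.formsPullback a).toLinearMap z = (g.formsPullback a).toLinearMap x := by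
  obtain ⟨C, hC⟩ := hf.exists_contraction
  obtain ⟨N, hN⟩ := hg
  have hC0 : C.sub 0 = LinearMap.ker f.toLinearMap := (hC 0).trans (inf_top_eq _)
  let L : (g.forms n).AcyclicFiltration :=
    C.acyclicFiltration (A := cdga k (Fin (n + 1))) (B := boundaryIdeal k n)
      fun a _ hb => mul_mem_boundaryIdeal a hb
  -- Elements of the filtration are invisible both to `f` and to the boundary, so they are
  -- admissible corrections of `x`.
  have hL : ∀ z ∈ L.sub 0 1, (f.formsMap n).toLinearMap z = 0 ∧
      ∀ (m : ℕ) (a : SimplexCategory.mk m ⟶ SimplexCategory.mk n), m < n →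
        (g.formsPullback a).toLinearMap z = 0 := by
    intro z hz
    replace hz : z ∈ tensorSub (cdga k (Fin (n + 1))) g (boundaryIdeal k n) (C.sub 0) 1 := hz
    refine ⟨?_, fun m a hm => ?_⟩
    · refine Submodule.span_le (p := LinearMap.ker (f.formsMap n).toLinearMap).2 ?_ hz
      rintro _ ⟨i, j, -, b, hb, y, hy, rfl⟩
      refine LinearMap.mem_ker.2 ?_
      show b ⊗ₜ[k] f.toLinearMap y = 0
      rw [hC0] at hy
      rw [LinearMap.mem_ker.1 hy.1, TensorProduct.tmul_zero]
    · refine Submodule.span_le (p := LinearMap.ker (g.formsPullback a).toLinearMap).2 ?_ hz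
      rintro _ ⟨i, j, -, b, hb, y, hy, rfl⟩
      refine LinearMap.mem_ker.2 ?_
      show simplicialPullback k a b ⊗ₜ[k] y = 0
      rw [hb.1 m a hm, TensorProduct.zero_tmul]
  -- Curvature commutes with morphisms, so it dies wherever the image of `x` satisfies the
  -- Maurer–Cartan equation.
  have hR : (g.forms n).curvature x ∈ L.sub 0 2 := by
    show _ ∈ tensorSub (cdga k (Fin (n + 1))) g (boundaryIdeal k n) (C.sub 0) 2
    rw [hC0]
    refine Hom.mem_tensorSub hf.surjective (curvature_mem hx) ?_ fun m a hm => ?_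
    · rw [Hom.map_curvature, curvature_eq_zero hfx]
    · rw [Hom.map_curvature, curvature_eq_zero (hb m a hm)]
  have hL2 : L.sub N 2 = ⊥ := by
    show tensorSub (cdga k (Fin (n + 1))) g (boundaryIdeal k n) (C.sub N) 2 = ⊥
    rw [hC, hN, inf_bot_eq]
    exact tensorSub_bot 2
  obtain ⟨z, hz, hxz⟩ := L.exists_MC hL2 hx hR
  refine ⟨x - z, hxz, ?_, fun m a hm => ?_⟩
  · rw [map_sub, (hL z hz).1, sub_zero]
  · rw [map_sub, (hL z hz).2 m a hm, sub_zero]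

/-- The forms of degree `p` with values in the kernel of a morphism. -/
def Hom.kerForms (f : g.Hom h) (p n : ℕ) : AddSubgroup ((tensorModule k g.carrier).obj n) :=
  ((g.forms n).deg p ⊓ LinearMap.ker (f.formsMap n).toLinearMap).toAddSubgroup

/-- Through this stability, `CoordModule.exists_extension` produces extensions that keep the degree
and stay in the kernel of `f`. -/
theorem Hom.isStable_kerForms (f : g.Hom h) (p : ℕ) :
    (tensorModule k g.carrier).IsStable (f.kerForms p) where
  act_mem a x hx := by
    refine ⟨(g.formsPullback a).map_deg hx.1, LinearMap.mem_ker.2 ?_⟩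
    refine (f.formsMap_formsPullback a x).trans ?_
    rw [LinearMap.mem_ker.1 hx.2, map_zero]
  coord_mem {n} i x hx := by
    refine ⟨?_, LinearMap.mem_ker.2 ?_⟩
    · refine Submodule.span_le (p := ((g.forms n).deg p).comap
        (LinearMap.rTensor g.carrier (LinearMap.mulLeft k (t k i)))).2 ?_ hx.1
      rintro _ ⟨q, r, hqr, a, ha, y, hy, rfl⟩
      exact tmul_mem_tensorDeg _ _ hqr (t_mul_mem k i ha) hy
    · have e : (f.formsMap n).toLinearMap ∘ₗ
            LinearMap.rTensor g.carrier (LinearMap.mulLeft k (t k i)) =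
          LinearMap.rTensor h.carrier (LinearMap.mulLeft k (t k i)) ∘ₗ
            (f.formsMap n).toLinearMap := TensorProduct.ext' fun ω x => rfl
      refine (LinearMap.congr_fun e x).trans ?_
      have hx0 : (f.formsMap n).toLinearMap x = 0 := LinearMap.mem_ker.1 hx.2
      exact (congrArg ((tensorModule k h.carrier).coord i) hx0).trans (map_zero _)

/-- Maurer--Cartan elements lift along an acyclic fibration, with prescribed boundary. -/
theorem Hom.IsAcyclicFibration.exists_lift [CharZero k] (hf : f.IsAcyclicFibration)
    (hg : g.IsNilpotent) {n : ℕ} (x : Fin (n + 2) → (g.forms n).MC) (y : (h.forms (n + 1)).MC)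
    (hx : CoordModule.IsCompatible (M := tensorModule k g.carrier) fun i => (x i).1)
    (hxy : ∀ i, (f.formsMap n).toLinearMap (x i).1 =
      (h.formsPullback (SimplexCategory.δ i)).toLinearMap y.1) :
    ∃ z ∈ (g.forms (n + 1)).MC,
      (∀ i, (g.formsPullback (SimplexCategory.δ i)).toLinearMap z = (x i).1) ∧
      (f.formsMap (n + 1)).toLinearMap z = y.1 := by
  obtain ⟨y', hy'd, hy'⟩ := Hom.exists_formsMap_eq hf.surjective y.2.1
  have hc : CoordModule.IsCompatible (M := tensorModule k g.carrier)
      fun i => (x i).1 - (g.formsPullback (SimplexCategory.δ i)).toLinearMap y' := by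
    intro m a b i j hab
    refine (map_sub ((tensorModule k g.carrier).act a) _ _).trans
      (Eq.trans ?_ (map_sub ((tensorModule k g.carrier).act b) _ _).symm)
    refine congrArg₂ (· - ·) (hx m a b i j hab) ?_
    refine (g.formsPullback_comp a (SimplexCategory.δ i) y').symm.trans ?_
    rw [hab]
    exact g.formsPullback_comp b (SimplexCategory.δ j) y'
  -- The defects of `y'` on the faces take values in `ker f`, because `x i` and the face of `y'`
  -- have the same image. Correcting them therefore leaves the image of `y'` unchanged.
  obtain ⟨z, hz, hzx⟩ := CoordModule.exists_extension (f.isStable_kerForms 1) hc fun i =>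
    ⟨sub_mem (x i).2.1 ((g.formsPullback _).map_deg hy'd), LinearMap.mem_ker.2 (by
      rw [map_sub, hxy, f.formsMap_formsPullback, hy', sub_self])⟩
  obtain ⟨z, rfl⟩ : ∃ z₀ : (g.forms (n + 1)).carrier, z₀ = z := ⟨z, rfl⟩
  have hδ : ∀ i, (g.formsPullback (SimplexCategory.δ i)).toLinearMap (y' + z) = (x i).1 := by
    intro i
    rw [map_add]
    exact (congrArg _ (hzx i)).trans (add_sub_cancel _ _)
  have hfz : (f.formsMap (n + 1)).toLinearMap (y' + z) = y.1 := by
    rw [map_add, hy', LinearMap.mem_ker.1 hz.2, add_zero]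
  -- The form `y' + z` has the right image and faces, but need not satisfy the Maurer–Cartan
  -- equation. Its restriction to any smaller simplex factors through a face, where the equation
  -- holds.
  obtain ⟨z', hz', h1, h2⟩ := hf.exists_MC hg (add_mem hy'd hz.1) (by rw [hfz]; exact y.2)
    (fun m a hm => by
      obtain ⟨i, b, rfl⟩ := SimplexCategory.eq_comp_δ_of_not_surjective a (fun hs => by
        rw [← SimplexCategory.epi_iff_surjective] at hs
        have : n + 1 ≤ m := SimplexCategory.len_le_of_epi a
        omega)
      rw [formsPullback_comp, hδ]
      exact (g.formsPullback b).map_mem_MC (x i).2)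
  exact ⟨z', hz', fun i => (h2 n _ n.lt_succ_self).trans (hδ i), h1.trans hfz⟩

theorem Hom.IsAcyclicFibration.rlp_contentsMap [CharZero k] (hf : f.IsAcyclicFibration)
    (hg : g.IsNilpotent) :
    (MorphismProperty.monomorphisms SSet.{max u v}).rlp f.contentsMap := by
  refine SSet.rlp_monomorphisms_of_exists_lift (fun y => ?_) (fun n x y hx hxy => ?_)
  -- For vertices the boundary condition is empty, and any lift of degree one can be deformed.
  · obtain ⟨x, hxd, hx⟩ := Hom.exists_formsMap_eq hf.surjective (n := 0) y.2.1
    obtain ⟨z, hz, hzx, -⟩ := hf.exists_MC hg hxd (by rw [hx]; exact y.2)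
      (fun m a hm => absurd hm (Nat.not_lt_zero m))
    exact ⟨⟨z, hz⟩, Subtype.ext (hzx.trans hx)⟩
  · obtain ⟨z, hz, hzx, hzy⟩ := hf.exists_lift hg x y
      (fun m a b i j hab => congrArg Subtype.val (hx m a b i j hab))
      (fun i => congrArg Subtype.val (hxy i))
    exact ⟨⟨z, hz⟩, fun i => Subtype.ext (hzx i), Subtype.ext hzy⟩

end DGLieAlgebra

end

theorem mainTheorem6 (k : Type u) [Field k] [CharZero k] (g h : DGLieAlgebra.{u, v} k)
    (hg : g.IsNilpotent) (hh : h.IsNilpotent) (f : g.Hom h) (hf : f.IsAcyclicFibration) :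
    SSet.IsAcyclicFibration f.contentsMap ∧
      (MorphismProperty.monomorphisms SSet.{max u v}).rlp f.contentsMap :=
  ⟨SSet.isAcyclicFibration_of_rlp (hf.rlp_contentsMap hg), hf.rlp_contentsMap hg⟩
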